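/- **Theorem (Indistinguishability Amplification).** *Setting.* Let $\mathcal X$ be a measurable space and let $\mathcal H\subseteq\{0,1\}^{\mathcal X}$ be a set of classifiers which, with the trace of the product $\sigma$-algebra, is a standard Borel space and for which the evaluation map $(h,x)\mapsto h(x)$ is measurable on $\mathcal H\times\mathcal X$ (for instance, $\mathcal X$ countable and discrete and $\mathcal H=\{0,1\}^{\mathcal X}$). An $n$-sample learning rule $A$ is a Markov kernel that sends a sample $S\in(\mathcal X\times\{0,1\})^n$ to a probability measure $A(S)$ on $\mathcal H$. For a probability measure $\mathcal D$ on $\mathcal X\times\{0,1\}$ put $\mathrm{err}_{\mathcal D}(h)=\Pr_{(x,y)\sim\mathcal D}[h(x)\neq y]$. The rule $A$ is * $\rho$-TV indistinguishable with respect to $\mathcal D$ if $\mathbf E_{S,S'\sim\mathcal D^n}[d_{\mathrm{TV}}(A(S),A(S'))]\le\rho$ for independent $S,S'$, where $d_{\mathrm{TV}}(P,Q)=\sup_B (P(B)-Q(B))$ over measurable $B$; * $(\alpha,\beta)$-accurate for $\mathcal D$ if $\Pr_{S\sim\mathcal D^n,\,h\sim A(S)}[\mathrm{err}_{\mathcal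 D}(h)>\alpha]\le\beta$; * absolutely continuous with respect to a measure $\mathcal P$ on $\mathcal H$ on inputs from $\mathcal D$ if $A(S)\ll\mathcal P$ for $\mathcal D^n$-almost every $S$. *Statement.* There are universal constants $C>0$ and $m\in\mathbb N$ such that the following holds for all $\mathcal X,\mathcal H$ as above. Let $\mathcal P$ be a probability measure on $\mathcal H$, let $\mathcal R$ be (the law of an enumeration $r=\{(h_i,y_i,t_i)\}_{i\in\mathbb N}$ of the points of) a Poisson point process with intensity $\mathcal P\times\mathrm{Leb}\times\mathrm{Leb}$ on $\mathcal H\times\mathbb R_+\times\mathbb R_+$, let $A$ be an $n$-sample learning rule, and let $\rho,\alpha,\beta\in(0,1)$ with $$\beta<\frac{2\rho}{\rho+1}-2\sqrt{\frac{2\rho}{\rho+1}}+1 .$$ Then for all $\rho',\varepsilon,\beta'\in(0,1)$ there are $n',k\in\mathbb N$ and a learning algorithm $A'$, i.e. a measurable map $(S,r_1,\dots,r_k)\mapsto A'(S,r_1,\dots,r_k)\in\mathcal H$ of a sample $S\in(\mathcal X\times\{0,1\})^{n'}$ and of $k$ independent draws $r_1,\dots,r_k\sim\mathcal R$ (its internal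 randomness), none of which depends on a distribution $\mathcal D$, such that $$n'\le C\,T\,\bigl(\log(e+T)\bigr)^m\cdot\max(n,1),\qquad T=\frac{\log^3(3/\beta')}{\Bigl(\frac{2\rho}{\rho+1}-2\sqrt{\frac{2\rho}{\rho+1}}+1-\beta\Bigr)^2\Bigl(1-\sqrt{\frac{2\rho}{\rho+1}}\Bigr)\varepsilon^2\rho'^2},$$ and, for every probability measure $\mathcal D$ on $\mathcal X\times\{0,1\}$ such that $A$ is (i) $\rho$-TV indistinguishable with respect to $\mathcal D$, (ii) $(\alpha,\beta)$-accurate for $\mathcal D$, and (iii) absolutely continuous with respect to $\mathcal P$ on inputs from $\mathcal D$, the learning rule $S\mapsto \mathrm{law}\,(A'(S,r_1,\dots,r_k))$ is $\rho'$-TV indistinguishable with respect to $\mathcal D$ and $(\alpha+\varepsilon,\beta')$-accurate for $\mathcal D$. In particular the sample complexity is polylogarithmic in $1/\beta'$. -/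

import Mathlib

open MeasureTheory ProbabilityTheory
open scoped ENNReal

noncomputable section

namespace TVLearning

/-- Labelled samples of size `n` over the domain `X`, with labels `{0, 1}` encoded as `Bool`. -/
abbrev Sample (X : Type*) (n : ℕ) : Type _ := Fin n → X × Bool

/-- The total variation distance `sup_B (P B - Q B)` over measurable `B`. The subtraction of
`ℝ≥0∞` truncates at `0`, which does not change the supremum (take `B = ∅`). -/
def tvDist {Ω : Type*} [MeasurableSpace Ω] (P Q : Measure Ω) : ℝ≥0∞ :=
  ⨆ (B : Set Ω) (_ : MeasurableSet B), (P B - Q B)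

section Rules

variable {X : Type*} [MeasurableSpace X] {H : Set (X → Bool)} {n : ℕ}

/-- The misclassification probability `Pr_{(x,y) ∼ D} [h x ≠ y]` of a classifier `h`. -/
def err (D : Measure (X × Bool)) (h : X → Bool) : ℝ :=
  D.real {z | h z.1 ≠ z.2}

/-- The law of an i.i.d. sample of size `n` from `D`. -/
def sampleLaw (D : Measure (X × Bool)) (n : ℕ) : Measure (Sample X n) :=
  Measure.pi fun _ => D

/-- The learning rule `A` (a map from samples to distributions over classifiers) is
`ρ`-TV indistinguishable with respect to `D`:
`E_{S, S' ∼ D^n} [d_TV (A(S), A(S'))] ≤ ρ` for independent `S`, `S'`. -/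
def IsTVIndistinguishable (A : Kernel (Sample X n) H) (D : Measure (X × Bool)) (ρ : ℝ) : Prop :=
  ∫⁻ S, ∫⁻ S', tvDist (A S) (A S') ∂(sampleLaw D n) ∂(sampleLaw D n) ≤ ENNReal.ofReal ρ

/-- The learning rule `A` is `(α, β)`-accurate for `D`: over the draw of `S ∼ D^n` and of the
output `h ∼ A(S)`, the misclassification probability of `h` exceeds `α` with probability
at most `β`. -/
def IsAccurate (A : Kernel (Sample X n) H) (D : Measure (X × Bool)) (α β : ℝ) : Prop :=
  ∫⁻ S, A S {h : H | α < err D h} ∂(sampleLaw D n) ≤ ENNReal.ofReal β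

/-- The learning rule `A` is absolutely continuous with respect to `P` on inputs from `D`. -/
def IsAbsContOn (A : Kernel (Sample X n) H) (P : Measure H) (D : Measure (X × Bool)) : Prop :=
  ∀ᵐ S ∂(sampleLaw D n), A S ≪ P

/-- A learning algorithm that takes `n` labelled examples and a random string in `Ω`, and outputs
a classifier, as a deterministic (measurable) function of the two. -/
structure LearningAlgorithm (X : Type*) [MeasurableSpace X] (H : Set (X → Bool))
    (Ω : Type*) [MeasurableSpace Ω] (n : ℕ) where
  toFun : Sample X n × Ω → H
  measurable_toFun : Measurable toFun

/-- The learning rule of a learning algorithm: `A(S)` is the law of `A(S, r)` for `r ∼ μ`. -/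
def LearningAlgorithm.rule {Ω : Type*} [MeasurableSpace Ω] (A : LearningAlgorithm X H Ω n)
    (μ : Measure Ω) : Kernel (Sample X n) H :=
  Kernel.map (Kernel.id ×ₖ Kernel.const _ μ) A.toFun

theorem LearningAlgorithm.rule_apply {Ω : Type*} [MeasurableSpace Ω]
    (A : LearningAlgorithm X H Ω n) (μ : Measure Ω) [SFinite μ] (S : Sample X n) :
    A.rule μ S = μ.map (fun r => A.toFun (S, r)) := by
  rw [LearningAlgorithm.rule, Kernel.map_apply _ A.measurable_toFun, Kernel.prod_apply,
    Kernel.id_apply, Kernel.const_apply, Measure.dirac_prod,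
    Measure.map_map A.measurable_toFun measurable_prodMk_left]
  rfl

end Rules

section Poisson

/-- The counting measure `∑ i, δ_{r i}` of a sequence of points: `pointCount r B` is the number of
indices `i` with `r i ∈ B`. -/
def pointCount {E : Type*} [MeasurableSpace E] (r : ℕ → E) : Measure E :=
  Measure.sum fun i => Measure.dirac (r i)

/-- The random sequence of points with law `R` is an enumeration of a Poisson point process with
intensity `Λ` (of infinite total mass): the number of points in a measurable set `B` of finite
intensity is a Poisson variable of mean `Λ B`, and the numbers of points in finitely many pairwise
disjoint measurable sets are independent. -/
structure IsPoissonPointProcess {E : Type*} [MeasurableSpace E] (R : Measure (ℕ → E))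
    (Λ : Measure E) : Prop where
  isProbabilityMeasure : IsProbabilityMeasure R
  map_count : ∀ B : Set E, MeasurableSet B → Λ B ≠ ∞ →
    R.map (fun r => pointCount r B)
      = (poissonMeasure (Λ B).toNNReal).map (Nat.cast : ℕ → ℝ≥0∞)
  indep_count : ∀ (m : ℕ) (B : Fin m → Set E), (∀ i, MeasurableSet (B i)) →
    Pairwise (fun i j => Disjoint (B i) (B j)) →
    iIndepFun (fun i r => pointCount r (B i)) R

/-- Lebesgue measure on `ℝ₊`, as a measure on `ℝ` that is carried by `[0, ∞)`. -/
def lebNonneg : Measure ℝ :=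
  (volume : Measure ℝ).restrict (Set.Ici 0)

/-- The intensity `P × Leb × Leb` on `H × ℝ₊ × ℝ₊`, as a measure on `H × ℝ × ℝ`. -/
def poissonIntensity {H : Type*} [MeasurableSpace H] (P : Measure H) : Measure (H × ℝ × ℝ) :=
  P.prod (lebNonneg.prod lebNonneg)

end Poisson

/-- The main factor of the sample complexity of the amplified learner, where
`s = √(2ρ / (ρ + 1))`. -/
def amplFactor (ρ β ρ' ε β' : ℝ) : ℝ :=
  Real.log (3 / β') ^ 3 /
    ((2 * ρ / (ρ + 1) - 2 * √(2 * ρ / (ρ + 1)) + 1 - β) ^ 2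
      * (1 - √(2 * ρ / (ρ + 1))) * ε ^ 2 * ρ' ^ 2)

end TVLearning

end

/-! Write η = 2ρ/(ρ+1) and s = 1 - √η; the hypothesis on β says that g = s² - β is positive.

Sharing a Poisson process r turns indistinguishability into agreement. The earliest point of r under
the graph of the density of `A S` has law `A S`. For two samples these points coincide with
probability at least the ratio of the intersection to the union of the two regions, so the outputs
differ with probability at most 2d/(1+d), where d is the total variation distance. Concavity in d
gives average disagreement at most η (`map_corrSample`, `prob_corrSample_ne_le`). By Markov's
inequality, with probability at least g over r, some classifier of error at most α is the output on
a fraction at least s of all samples (`exists_accurate_heavy_hitter`).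

Among k independent strings one is of this kind except with probability exp(-gk). It remains to
select among the km candidates produced from m blocks of data in a way that hardly depends on the
data. The selection is an exponential mechanism: the score rewards frequency up to s and penalizes
empirical error above α. Frequencies and errors concentrate by Hoeffding's inequality, with a union
bound over the km candidates only, so no capacity of H enters. Frequent candidates have nearly equal
scores in two independent samples, while the rare ones, and the inaccurate ones, have a share of at
most km exp(-lam/2), because the heavy hitter outscores them (`weightSum_div_le_of_matched`,
`weightSum_inaccurate_le`). The randomness of the selection is read off one more Poisson process. -/

noncomputable section

namespace TVLearning

/-! ### Poisson races: the earliest point in a region. -/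

section PoissonRace

variable {H : Type*} [MeasurableSpace H]

instance : SFinite lebNonneg := by unfold lebNonneg; infer_instance

/-- The points of `H × ℝ × ℝ₊` whose first two coordinates lie in `G` and whose last coordinate,
the arrival time, is less than `t`. -/
def slab (G : Set (H × ℝ)) (t : ℝ) : Set (H × ℝ × ℝ) :=
  {p | (p.1, p.2.1) ∈ G ∧ p.2.2 ∈ Set.Ico 0 t}

theorem measurableSet_slab {G : Set (H × ℝ)} (hG : MeasurableSet G) (t : ℝ) :
    MeasurableSet (slab G t) := by
  unfold slab
  have h1 : Measurable fun p : H × ℝ × ℝ => (p.1, p.2.1) := by fun_prop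
  have h2 : Measurable fun p : H × ℝ × ℝ => p.2.2 := by fun_prop
  exact (h1 hG).inter (h2 measurableSet_Ico)

theorem poissonIntensity_slab (P : Measure H) [SFinite P] {G : Set (H × ℝ)}
    (hG : MeasurableSet G) (t : ℝ) :
    poissonIntensity P (slab G t) = P.prod lebNonneg G * ENNReal.ofReal t := by
  have h := (measurePreserving_prodAssoc P lebNonneg lebNonneg).measure_preimage
    (measurableSet_slab hG t).nullMeasurableSet
  rw [poissonIntensity, ← h]
  have : (MeasurableEquiv.prodAssoc ⁻¹' slab G t : Set ((H × ℝ) × ℝ)) = G ×ˢ Set.Ico 0 t := by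
    ext p; simp [slab, MeasurableEquiv.prodAssoc]
  rw [this, Measure.prod_prod]
  congr 1
  rw [lebNonneg, Measure.restrict_apply measurableSet_Ico,
    Set.inter_eq_left.mpr (fun x hx => hx.1), Real.volume_Ico, sub_zero]

/-- No point of `r` lies in `B`. -/
def voidEvent {E : Type*} (B : Set E) : Set (ℕ → E) := {r | ∀ i, r i ∉ B}

theorem measurableSet_voidEvent {E : Type*} [MeasurableSpace E] {B : Set E}
    (hB : MeasurableSet B) : MeasurableSet (voidEvent B) := by
  have : voidEvent B = ⋂ i : ℕ, (fun r : ℕ → E => r i) ⁻¹' Bᶜ := by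
    ext r; simp [voidEvent]
  rw [this]
  exact MeasurableSet.iInter fun i => measurable_pi_apply i hB.compl

theorem pointCount_apply {E : Type*} [MeasurableSpace E] (r : ℕ → E) {B : Set E}
    (hB : MeasurableSet B) : pointCount r B = ∑' i, B.indicator 1 (r i) := by
  simp [pointCount, Measure.sum_apply _ hB, Measure.dirac_apply' _ hB]

theorem measurable_pointCount {E : Type*} [MeasurableSpace E] {B : Set E}
    (hB : MeasurableSet B) : Measurable fun r : ℕ → E => pointCount r B := by
  simp_rw [pointCount_apply _ hB]
  refine Measurable.tsum fun i => ?_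
  exact (measurable_one.indicator hB).comp (measurable_pi_apply i)

theorem IsPoissonPointProcess.void_probability {E : Type*} [MeasurableSpace E]
    {R : Measure (ℕ → E)} {Λ : Measure E} (hR : IsPoissonPointProcess R Λ) {B : Set E}
    (hB : MeasurableSet B) (hΛ : Λ B ≠ ∞) :
    R (voidEvent B) = ENNReal.ofReal (Real.exp (-(Λ B).toReal)) := by
  have h1 : voidEvent B = (fun r => pointCount r B) ⁻¹' {0} := by
    ext r
    simp [voidEvent, pointCount_apply r hB]
  rw [h1, ← Measure.map_apply (measurable_pointCount hB) (measurableSet_singleton _),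
    hR.map_count B hB hΛ, Measure.map_apply (by fun_prop) (measurableSet_singleton _)]
  have : (Nat.cast : ℕ → ℝ≥0∞) ⁻¹' {0} = {0} := by ext; simp
  rw [this, poissonMeasure_singleton]
  simp only [pow_zero, mul_one, Nat.factorial_zero, Nat.cast_one, div_one]
  rfl

theorem IsPoissonPointProcess.ae_finite {E : Type*} [MeasurableSpace E]
    {R : Measure (ℕ → E)} {Λ : Measure E} (hR : IsPoissonPointProcess R Λ) {B : Set E}
    (hB : MeasurableSet B) (hΛ : Λ B ≠ ∞) : ∀ᵐ r ∂ R, {i | r i ∈ B}.Finite := by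
  have h1 : ∀ᵐ r ∂ R, pointCount r B ≠ ∞ := by
    have : ∀ᵐ x ∂(R.map fun r => pointCount r B), x ≠ ∞ := by
      rw [hR.map_count B hB hΛ, ae_map_iff (by fun_prop) (by measurability)]
      simp
    exact ae_of_ae_map (measurable_pointCount hB).aemeasurable this
  filter_upwards [h1] with r hr
  rw [pointCount_apply r hB] at hr
  refine (ENNReal.finite_const_le_of_tsum_ne_top hr one_ne_zero).subset fun i hi => ?_
  simp only [Set.mem_ofPred_eq] at hi ⊢
  simp [hi]

/-- The point `p` has its first two coordinates in `G` and a nonnegative arrival time. -/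
def InRegion (G : Set (H × ℝ)) (p : H × ℝ × ℝ) : Prop := (p.1, p.2.1) ∈ G ∧ 0 ≤ p.2.2

theorem measurableSet_inRegion {α : Type*} [MeasurableSpace α] {G : Set (α × (H × ℝ))}
    (hG : MeasurableSet G) :
    MeasurableSet {p : α × (H × ℝ × ℝ) | InRegion {q | (p.1, q) ∈ G} p.2} := by
  have h1 : Measurable fun p : α × (H × ℝ × ℝ) => (p.1, (p.2.1, p.2.2.1)) := by fun_prop
  have h2 : Measurable fun p : α × (H × ℝ × ℝ) => p.2.2.2 := by fun_prop
  exact (h1 hG).inter (h2 measurableSet_Ici)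

/-- The `i`-th point of `r` has the least arrival time among the points in the region `G`. -/
def IsFirst (G : Set (H × ℝ)) (r : ℕ → H × ℝ × ℝ) (i : ℕ) : Prop :=
  InRegion G (r i) ∧ ∀ j, InRegion G (r j) → (r i).2.2 ≤ (r j).2.2

theorem measurableSet_isFirst {α : Type*} [MeasurableSpace α] {G : Set (α × (H × ℝ))}
    (hG : MeasurableSet G) (i : ℕ) :
    MeasurableSet {p : α × (ℕ → H × ℝ × ℝ) | IsFirst {q | (p.1, q) ∈ G} p.2 i} := by
  have hIn (j : ℕ) : MeasurableSet
      {p : α × (ℕ → H × ℝ × ℝ) | InRegion {q | (p.1, q) ∈ G} (p.2 j)} := by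
    have : Measurable fun p : α × (ℕ → H × ℝ × ℝ) => (p.1, p.2 j) := by fun_prop
    exact this (measurableSet_inRegion hG)
  refine (hIn i).inter ?_
  change MeasurableSet {p : α × (ℕ → H × ℝ × ℝ) | ∀ j, InRegion {q | (p.1, q) ∈ G} (p.2 j) →
    (p.2 i).2.2 ≤ (p.2 j).2.2}
  rw [Set.ofPred_forall]
  refine MeasurableSet.iInter fun j => ?_
  have h := measurableSet_le (α := ℝ) (f := fun p : α × (ℕ → H × ℝ × ℝ) => (p.2 i).2.2)
    (g := fun p => (p.2 j).2.2) (by fun_prop) (by fun_prop)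
  exact (hIn j).imp h

omit [MeasurableSpace H] in
-- The second alternative makes the search total: index 0 is the default when there is no earliest
-- point, so `firstPoint` is defined and measurable everywhere, not only almost surely.
theorem exists_isFirst_or (G : Set (H × ℝ)) (r : ℕ → H × ℝ × ℝ) :
    ∃ i, IsFirst G r i ∨ ∀ j, ¬ IsFirst G r j := by
  by_cases h : ∃ i, IsFirst G r i
  · exact h.imp fun i => Or.inl
  · exact ⟨0, Or.inr (not_exists.mp h)⟩

open Classical in
/-- The first two coordinates of the earliest point of `r` in the region `G`. -/
def firstPoint (G : Set (H × ℝ)) (r : ℕ → H × ℝ × ℝ) : H × ℝ :=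
  ((r (Nat.find (exists_isFirst_or G r))).1, (r (Nat.find (exists_isFirst_or G r))).2.1)

theorem measurable_firstPoint {α : Type*} [MeasurableSpace α] {G : Set (α × (H × ℝ))}
    (hG : MeasurableSet G) :
    Measurable fun p : α × (ℕ → H × ℝ × ℝ) => firstPoint {q | (p.1, q) ∈ G} p.2 := by
  classical
  refine Measurable.find (f := fun i (p : α × (ℕ → H × ℝ × ℝ)) => ((p.2 i).1, (p.2 i).2.1))
    (p := fun i p => IsFirst {q | (p.1, q) ∈ G} p.2 i ∨
      ∀ j, ¬ IsFirst {q | (p.1, q) ∈ G} p.2 j) (fun n => by fun_prop) (fun n => ?_)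
    (fun p => exists_isFirst_or {q | (p.1, q) ∈ G} p.2)
  refine (measurableSet_isFirst hG n).union ?_
  change MeasurableSet {p : α × (ℕ → H × ℝ × ℝ) | ∀ j, ¬ IsFirst {q | (p.1, q) ∈ G} p.2 j}
  rw [Set.ofPred_forall]
  exact MeasurableSet.iInter fun j => (measurableSet_isFirst hG j).compl

omit [MeasurableSpace H] in
theorem firstPoint_eq_of_exists {G : Set (H × ℝ)} {r : ℕ → H × ℝ × ℝ}
    (h : ∃ i, IsFirst G r i) : ∃ i, IsFirst G r i ∧ firstPoint G r = ((r i).1, (r i).2.1) := by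
  classical
  refine ⟨_, ?_, rfl⟩
  rcases Nat.find_spec (exists_isFirst_or G r) with h' | h'
  · exact h'
  · exact absurd h (not_exists.mpr h')

omit [MeasurableSpace H] in
theorem firstPoint_congr {G G' : Set (H × ℝ)} {r : ℕ → H × ℝ × ℝ}
    (h : ∀ i, IsFirst G r i ↔ IsFirst G' r i) : firstPoint G r = firstPoint G' r := by
  classical
  have h' : Nat.find (exists_isFirst_or G r) = Nat.find (exists_isFirst_or G' r) :=
    Nat.find_congr' fun {n} => by simp only [h]
  unfold firstPoint
  convert congrArg (fun i => ((r i).1, (r i).2.1)) h'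

/-- Some point in the region `G₁` arrives before all the points in the region `G₂`. -/
def Precedes (G₁ G₂ : Set (H × ℝ)) (r : ℕ → H × ℝ × ℝ) : Prop :=
  ∃ i, InRegion G₁ (r i) ∧ ∀ j, InRegion G₂ (r j) → (r i).2.2 < (r j).2.2

theorem one_sub_exp_neg_ge {x : ℝ} (h0 : 0 ≤ x) (h1 : x ≤ 1) :
    x * (1 - x) ≤ 1 - Real.exp (-x) := by
  have := Real.abs_exp_sub_one_sub_id_le (x := -x) (by rw [abs_neg, abs_of_nonneg h0]; exact h1)
  have := (abs_le.mp this).2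
  nlinarith

section Points

variable {P : Measure H} [IsProbabilityMeasure P] {R : Measure (ℕ → H × ℝ × ℝ)}

/-- Two slabs are both empty exactly when their union is, and disjointness makes the intensity of
the union additive, so one void probability suffices. -/
theorem IsPoissonPointProcess.void_pair (hR : IsPoissonPointProcess R (poissonIntensity P))
    {G₁ G₂ : Set (H × ℝ)} (h₁ : MeasurableSet G₁) (h₂ : MeasurableSet G₂)
    (hd : Disjoint G₁ G₂) (f₁ : P.prod lebNonneg G₁ ≠ ∞) (f₂ : P.prod lebNonneg G₂ ≠ ∞)
    {t u : ℝ} (ht : 0 ≤ t) (hu : 0 ≤ u) :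
    R.real (voidEvent (slab G₁ t) ∩ voidEvent (slab G₂ u)) =
      Real.exp (-((P.prod lebNonneg).real G₁ * t + (P.prod lebNonneg).real G₂ * u)) := by
  have h0 : voidEvent (slab G₁ t) ∩ voidEvent (slab G₂ u) =
      voidEvent (slab G₁ t ∪ slab G₂ u) := by
    ext r
    simp only [voidEvent, Set.mem_inter_iff, Set.mem_ofPred_eq, Set.mem_union, not_or]
    exact forall_and.symm
  have hdis : Disjoint (slab G₁ t) (slab G₂ u) := by
    rw [Set.disjoint_left] at hd ⊢
    exact fun p hp hp' => hd hp.1 hp'.1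
  have hm : poissonIntensity P (slab G₁ t ∪ slab G₂ u) =
      P.prod lebNonneg G₁ * ENNReal.ofReal t + P.prod lebNonneg G₂ * ENNReal.ofReal u := by
    rw [measure_union hdis (measurableSet_slab h₂ u), poissonIntensity_slab P h₁,
      poissonIntensity_slab P h₂]
  have hf1 : P.prod lebNonneg G₁ * ENNReal.ofReal t ≠ ∞ := ENNReal.mul_ne_top f₁ (by simp)
  have hf2 : P.prod lebNonneg G₂ * ENNReal.ofReal u ≠ ∞ := ENNReal.mul_ne_top f₂ (by simp)
  rw [h0, measureReal_def, hR.void_probability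
    ((measurableSet_slab h₁ t).union (measurableSet_slab h₂ u))
    (by rw [hm]; exact ENNReal.add_ne_top.mpr ⟨hf1, hf2⟩), hm, ENNReal.toReal_add hf1 hf2,
    ENNReal.toReal_mul, ENNReal.toReal_mul, ENNReal.toReal_ofReal ht, ENNReal.toReal_ofReal hu,
    ENNReal.toReal_ofReal (Real.exp_pos _).le]
  rfl

/-- Cut time into steps of length δ. The events that the first point of G₁ falls in step n while G₂
is still empty at the end of that step are disjoint, force `Precedes`, and have geometric
probabilities. -/
theorem IsPoissonPointProcess.le_precedes_grid
    (hR : IsPoissonPointProcess R (poissonIntensity P))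
    {G₁ G₂ : Set (H × ℝ)} (h₁ : MeasurableSet G₁) (h₂ : MeasurableSet G₂)
    (hd : Disjoint G₁ G₂) (f₁ : P.prod lebNonneg G₁ ≠ ∞) (f₂ : P.prod lebNonneg G₂ ≠ ∞)
    {a b : ℝ} (ha : (P.prod lebNonneg).real G₁ = a) (hb : (P.prod lebNonneg).real G₂ = b)
    (hab : 0 < a + b) {δ : ℝ} (hδ : 0 < δ) :
    Real.exp (-(b * δ)) * (1 - Real.exp (-(a * δ))) / (1 - Real.exp (-((a + b) * δ))) ≤
      R.real {r | Precedes G₁ G₂ r} := by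
  have := hR.isProbabilityMeasure
  let E : ℕ → Set (ℕ → H × ℝ × ℝ) := fun n =>
    (voidEvent (slab G₁ (n * δ)) ∩ voidEvent (slab G₂ ((n + 1 : ℕ) * δ))) \
      (voidEvent (slab G₁ ((n + 1 : ℕ) * δ)) ∩ voidEvent (slab G₂ ((n + 1 : ℕ) * δ)))
  have hv1 t := measurableSet_voidEvent (measurableSet_slab h₁ t)
  have hv2 t := measurableSet_voidEvent (measurableSet_slab h₂ t)
  have hE n : MeasurableSet (E n) := ((hv1 _).inter (hv2 _)).diff ((hv1 _).inter (hv2 _))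
  have hmono {s t : ℝ} (hst : s ≤ t) :
      voidEvent (slab G₁ t) ⊆ voidEvent (slab G₁ s) := by
    intro r hr i hi
    exact hr i ⟨hi.1, hi.2.1, hi.2.2.trans_le hst⟩
  have hEm n : R.real (E n) = Real.exp (-((a + b) * δ)) ^ n *
      (Real.exp (-(b * δ)) * (1 - Real.exp (-(a * δ)))) := by
    have hsub : voidEvent (slab G₁ ((n + 1 : ℕ) * δ)) ∩ voidEvent (slab G₂ ((n + 1 : ℕ) * δ)) ⊆
        voidEvent (slab G₁ (n * δ)) ∩ voidEvent (slab G₂ ((n + 1 : ℕ) * δ)) := by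
      refine Set.inter_subset_inter_left _ (hmono ?_)
      gcongr; simp
    rw [measureReal_sdiff hsub ((hv1 _).inter (hv2 _)),
      hR.void_pair h₁ h₂ hd f₁ f₂ (by positivity) (by positivity),
      hR.void_pair h₁ h₂ hd f₁ f₂ (by positivity) (by positivity), ha, hb, mul_sub, mul_sub,
      ← Real.exp_nat_mul, mul_one, ← Real.exp_add, ← Real.exp_add, ← Real.exp_add]
    push_cast
    congr 2 <;> ring
  have hdisj : Pairwise (Function.onFun Disjoint E) := by
    have key {p q : ℕ} (hpq : p < q) : Disjoint (E p) (E q) := by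
      rw [Set.disjoint_left]
      intro r hp hq
      refine hp.2 ⟨hmono ?_ hq.1.1, hp.1.2⟩
      gcongr; exact_mod_cast hpq
    intro p q hpq
    rcases lt_or_gt_of_ne hpq with h | h
    · exact key h
    · exact (key h).symm
  have hsub : (⋃ n, E n) ⊆ {r | Precedes G₁ G₂ r} := by
    intro r hr
    obtain ⟨n, hn⟩ := Set.mem_iUnion.mp hr
    have h1 : r ∉ voidEvent (slab G₁ ((n + 1 : ℕ) * δ)) := fun h => hn.2 ⟨h, hn.1.2⟩
    simp only [voidEvent, Set.mem_ofPred_eq, not_forall, not_not] at h1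
    obtain ⟨i, hi⟩ := h1
    refine ⟨i, ⟨hi.1, hi.2.1⟩, fun j hj => ?_⟩
    by_contra hlt
    exact hn.1.2 j ⟨hj.1, hj.2, (not_lt.mp hlt).trans_lt hi.2.2⟩
  have hx : Real.exp (-((a + b) * δ)) < 1 := by
    rw [Real.exp_lt_one_iff]; nlinarith
  have hsum : HasSum (fun n => R.real (E n))
      ((1 - Real.exp (-((a + b) * δ)))⁻¹ *
        (Real.exp (-(b * δ)) * (1 - Real.exp (-(a * δ))))) := by
    simp_rw [hEm]
    exact (hasSum_geometric_of_lt_one (Real.exp_pos _).le hx).mul_right _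
  have hU : R.real (⋃ n, E n) = ∑' n, R.real (E n) := by
    rw [measureReal_def, measure_iUnion hdisj hE, ENNReal.tsum_toReal_eq (by simp)]
    rfl
  rw [div_eq_inv_mul, ← hsum.tsum_eq, ← hU]
  exact measureReal_mono hsub

/-- The limit δ → 0 in `le_precedes_grid`. Lower bounds are enough: between probability measures
they force equality. -/
theorem IsPoissonPointProcess.le_precedes
    (hR : IsPoissonPointProcess R (poissonIntensity P))
    {G₁ G₂ : Set (H × ℝ)} (h₁ : MeasurableSet G₁) (h₂ : MeasurableSet G₂)
    (hd : Disjoint G₁ G₂) (f₁ : P.prod lebNonneg G₁ ≠ ∞) (f₂ : P.prod lebNonneg G₂ ≠ ∞)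
    {a b : ℝ} (ha : (P.prod lebNonneg).real G₁ = a) (hb : (P.prod lebNonneg).real G₂ = b)
    (hab : 0 < a + b) : a / (a + b) ≤ R.real {r | Precedes G₁ G₂ r} := by
  have ha0 : 0 ≤ a := ha ▸ measureReal_nonneg
  have hb0 : 0 ≤ b := hb ▸ measureReal_nonneg
  have hlim : Filter.Tendsto (fun δ : ℝ => (1 - b * δ) * (a * (1 - a * δ)) / (a + b))
      (nhdsWithin 0 (Set.Ioi 0)) (nhds (a / (a + b))) := by
    have : Continuous fun δ : ℝ => (1 - b * δ) * (a * (1 - a * δ)) / (a + b) := by fun_prop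
    have h := this.tendsto 0
    simp only [mul_zero, sub_zero, mul_one, one_mul] at h
    exact h.mono_left nhdsWithin_le_nhds
  refine le_of_tendsto hlim ?_
  have hsmall : Set.Ioo (0 : ℝ) (1 / (a + b)) ∈ nhdsWithin (0 : ℝ) (Set.Ioi 0) :=
    Ioo_mem_nhdsGT (by positivity)
  filter_upwards [hsmall] with δ hδ
  refine le_trans ?_ (hR.le_precedes_grid h₁ h₂ hd f₁ f₂ ha hb hab hδ.1)
  have hδ1 : (a + b) * δ < 1 := by
    have := hδ.2; rw [lt_div_iff₀ hab] at this; linarith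
  have hδ0 := hδ.1
  have haδ : a * δ ≤ 1 := by nlinarith
  have hbδ : b * δ ≤ 1 := by nlinarith
  have e1 := one_sub_exp_neg_ge (x := a * δ) (by positivity) haδ
  have e2 : 1 - b * δ ≤ Real.exp (-(b * δ)) := by
    have := Real.add_one_le_exp (-(b * δ)); linarith
  have e3 : 1 - Real.exp (-((a + b) * δ)) ≤ (a + b) * δ := by
    have := Real.add_one_le_exp (-((a + b) * δ)); linarith
  have e4 : 0 < 1 - Real.exp (-((a + b) * δ)) := by
    rw [sub_pos, Real.exp_lt_one_iff]; nlinarith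
  rw [div_le_div_iff₀ hab e4]
  have e5 : (1 - b * δ) * (a * δ * (1 - a * δ)) ≤
      Real.exp (-(b * δ)) * (1 - Real.exp (-(a * δ))) := by
    refine mul_le_mul e2 e1 ?_ (Real.exp_pos _).le
    have : 0 ≤ 1 - a * δ := by linarith
    positivity
  have e6 : 0 ≤ (1 - b * δ) * (a * (1 - a * δ)) := by
    have : 0 ≤ 1 - a * δ := by linarith
    have : 0 ≤ 1 - b * δ := by linarith
    positivity
  calc _ ≤ (1 - b * δ) * (a * (1 - a * δ)) * ((a + b) * δ) := by gcongr
    _ = (1 - b * δ) * (a * δ * (1 - a * δ)) * (a + b) := by ring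
    _ ≤ _ := by gcongr

/-- Finite intensity leaves finitely many points before each time N, so a minimum is attained once
some point exists; positive intensity makes the absence of points up to time N exponentially
unlikely. -/
theorem IsPoissonPointProcess.ae_exists_isFirst
    (hR : IsPoissonPointProcess R (poissonIntensity P)) {G : Set (H × ℝ)}
    (hG : MeasurableSet G) (hf : P.prod lebNonneg G ≠ ∞) (h0 : P.prod lebNonneg G ≠ 0) :
    ∀ᵐ r ∂ R, ∃ i, IsFirst G r i := by
  have := hR.isProbabilityMeasure
  have hfin : ∀ᵐ r ∂ R, ∀ N : ℕ, {i | r i ∈ slab G N}.Finite := by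
    rw [ae_all_iff]
    intro N
    refine hR.ae_finite (measurableSet_slab hG N) ?_
    rw [poissonIntensity_slab P hG]
    exact ENNReal.mul_ne_top hf (by simp)
  have hne : ∀ᵐ r ∂ R, ∃ i, InRegion G (r i) := by
    rw [ae_iff]
    have ha : 0 < (P.prod lebNonneg).real G := ENNReal.toReal_pos h0 hf
    have hle (N : ℕ) : R.real {r | ¬ ∃ i, InRegion G (r i)} ≤
        Real.exp (-(P.prod lebNonneg).real G) ^ N := by
      have h1 := hR.void_pair hG MeasurableSet.empty (by simp) hf (by simp)
        (Nat.cast_nonneg N) le_rfl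
      have h2 : {r : ℕ → H × ℝ × ℝ | ¬ ∃ i, InRegion G (r i)} ⊆
          voidEvent (slab G N) ∩ voidEvent (slab ∅ 0) := by
        intro r hr
        refine ⟨fun i hi => hr ⟨i, hi.1, hi.2.1⟩, fun i hi => hi.1⟩
      refine (measureReal_mono h2).trans ?_
      rw [h1, ← Real.exp_nat_mul]
      apply le_of_eq
      congr 1
      ring
    have hlim := tendsto_pow_atTop_nhds_zero_of_lt_one
      (Real.exp_pos (-(P.prod lebNonneg).real G)).le (by rw [Real.exp_lt_one_iff]; linarith)
    have h3 := ge_of_tendsto' hlim hle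
    exact (measureReal_eq_zero_iff).mp (le_antisymm h3 measureReal_nonneg)
  filter_upwards [hfin, hne] with r hr ⟨i, hi⟩
  obtain ⟨N, hN⟩ := exists_nat_gt (r i).2.2
  obtain ⟨j, hj, hmin⟩ := (hr N).toFinset.exists_min_image (fun j => (r j).2.2)
    ⟨i, by simpa using ⟨hi.1, hi.2, hN⟩⟩
  simp only [Set.Finite.mem_toFinset, Set.mem_ofPred_eq] at hj hmin
  refine ⟨j, ⟨hj.1, hj.2.1⟩, fun l hl => ?_⟩
  by_cases h : (r l).2.2 < N
  · exact hmin l ⟨hl.1, hl.2, h⟩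
  · exact hj.2.2.le.trans (not_lt.mp h)

theorem measurable_firstPoint_right {G : Set (H × ℝ)} (hG : MeasurableSet G) :
    Measurable (firstPoint G) := by
  have h := measurable_firstPoint (α := Unit) (G := Prod.snd ⁻¹' G) (measurable_snd hG)
  exact h.comp (measurable_prodMk_left (x := ()))

/-- The earliest point in the region `G` is distributed according to the intensity on `G`. -/
theorem IsPoissonPointProcess.map_firstPoint
    (hR : IsPoissonPointProcess R (poissonIntensity P)) {G : Set (H × ℝ)}
    (hG : MeasurableSet G) (h1 : P.prod lebNonneg G = 1) :
    R.map (firstPoint G) = (P.prod lebNonneg).restrict G := by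
  have := hR.isProbabilityMeasure
  have hf : P.prod lebNonneg G ≠ ∞ := by simp [h1]
  have hlow (B : Set (H × ℝ)) (hB : MeasurableSet B) :
      (P.prod lebNonneg).real (B ∩ G) ≤ R.real (firstPoint G ⁻¹' B) := by
    have hfin C : P.prod lebNonneg (C ∩ G) ≠ ∞ :=
      ne_top_of_le_ne_top hf (measure_mono Set.inter_subset_right)
    have hsum : (P.prod lebNonneg).real (B ∩ G) + (P.prod lebNonneg).real (Bᶜ ∩ G) = 1 := by
      have h := measureReal_inter_add_sdiff (μ := P.prod lebNonneg) (s := G) hB hf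
      rw [measureReal_def (P.prod lebNonneg) G, h1, ENNReal.toReal_one] at h
      rw [← h, Set.inter_comm, Set.inter_comm Bᶜ]
      rfl
    have h := hR.le_precedes (hB.inter hG) (hB.compl.inter hG)
      ((disjoint_compl_right).mono Set.inter_subset_left Set.inter_subset_left)
      (hfin _) (hfin _) rfl rfl (by rw [hsum]; exact one_pos)
    rw [hsum, div_one] at h
    refine h.trans ?_
    rw [measureReal_def, measureReal_def]
    refine ENNReal.toReal_mono (measure_ne_top _ _) (measure_mono_ae ?_)
    filter_upwards [hR.ae_exists_isFirst hG hf (by simp [h1])] with r hr hp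
    obtain ⟨i, hi, hfp⟩ := firstPoint_eq_of_exists hr
    obtain ⟨j, hj, hlt⟩ := hp
    change firstPoint G r ∈ B
    rw [hfp]
    by_contra hB'
    exact absurd (hi.2 j ⟨hj.1.2, hj.2⟩) (not_le.mpr (hlt i ⟨⟨hB', hi.1.1⟩, hi.1.2⟩))
  have hm := measurable_firstPoint_right hG
  have hprob : IsProbabilityMeasure (R.map (firstPoint G)) :=
    Measure.isProbabilityMeasure_map hm.aemeasurable
  have hprob' : IsProbabilityMeasure ((P.prod lebNonneg).restrict G) := ⟨by simp [h1]⟩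
  -- Domination of one probability measure by another is equality.
  refine (Measure.eq_of_le_of_isProbabilityMeasure ?_).symm
  refine Measure.le_iff.mpr fun B hB => ?_
  rw [Measure.map_apply hm hB, Measure.restrict_apply hB,
    ← ENNReal.toReal_le_toReal (ne_top_of_le_ne_top hf (measure_mono Set.inter_subset_right))
      (measure_ne_top _ _)]
  exact hlow B hB

/-- The earliest points in two regions coincide with probability at least the ratio of the
intensities of their intersection and their union. -/
theorem IsPoissonPointProcess.le_firstPoint_eq
    (hR : IsPoissonPointProcess R (poissonIntensity P)) {G G' : Set (H × ℝ)}
    (hG : MeasurableSet G) (hG' : MeasurableSet G') (h1 : P.prod lebNonneg G = 1)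
    (h1' : P.prod lebNonneg G' = 1) :
    (P.prod lebNonneg).real (G ∩ G') / (2 - (P.prod lebNonneg).real (G ∩ G')) ≤
      R.real {r | firstPoint G r = firstPoint G' r} := by
  have := hR.isProbabilityMeasure
  have hf : P.prod lebNonneg G ≠ ∞ := by simp [h1]
  have hf' : P.prod lebNonneg G' ≠ ∞ := by simp [h1']
  have hfi : P.prod lebNonneg (G ∩ G') ≠ ∞ :=
    ne_top_of_le_ne_top hf (measure_mono Set.inter_subset_left)
  have hfd : P.prod lebNonneg (G \ G') ≠ ∞ :=
    ne_top_of_le_ne_top hf (measure_mono Set.sdiff_subset)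
  have hfd' : P.prod lebNonneg (G' \ G) ≠ ∞ :=
    ne_top_of_le_ne_top hf' (measure_mono Set.sdiff_subset)
  have e1 := measureReal_inter_add_sdiff (μ := P.prod lebNonneg) (s := G) hG' hf
  have e2 := measureReal_inter_add_sdiff (μ := P.prod lebNonneg) (s := G') hG hf'
  have r1 : (P.prod lebNonneg).real G = 1 := by simp [measureReal_def, h1]
  have r2 : (P.prod lebNonneg).real G' = 1 := by simp [measureReal_def, h1']
  rw [Set.inter_comm] at e2
  have hdm : MeasurableSet ((G \ G') ∪ (G' \ G)) := (hG.diff hG').union (hG'.diff hG)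
  have hsum : (P.prod lebNonneg).real (G ∩ G') +
      (P.prod lebNonneg).real ((G \ G') ∪ (G' \ G)) =
        2 - (P.prod lebNonneg).real (G ∩ G') := by
    rw [measureReal_union (by
      rw [Set.disjoint_left]; exact fun x hx hx' => hx.2 hx'.1) (hG'.diff hG) hfd hfd']
    linarith
  have hle : (P.prod lebNonneg).real (G ∩ G') ≤ 1 := by
    linarith [measureReal_nonneg (μ := P.prod lebNonneg) (s := G \ G')]
  -- If a point of G ∩ G' precedes the whole symmetric difference, the earliest points of both
  -- regions lie in G ∩ G' and are the same.
  have h := hR.le_precedes (hG.inter hG') hdm (by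
      rw [Set.disjoint_left]
      rintro x hx (hx' | hx')
      · exact hx'.2 hx.2
      · exact hx'.2 hx.1) hfi
    (measure_union_ne_top hfd hfd') rfl rfl (by rw [hsum]; linarith)
  rw [hsum] at h
  refine h.trans ?_
  refine measureReal_mono ?_
  rintro r ⟨j, hj, hlt⟩
  refine firstPoint_congr fun i => ?_
  have key {G G' : Set (H × ℝ)} (hj : InRegion (G ∩ G') (r j))
      (hlt : ∀ l, InRegion ((G \ G') ∪ (G' \ G)) (r l) → (r j).2.2 < (r l).2.2)
      (hi : IsFirst G r i) : IsFirst G' r i := by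
    have hij : (r i).2.2 ≤ (r j).2.2 := hi.2 j ⟨hj.1.1, hj.2⟩
    refine ⟨⟨?_, hi.1.2⟩, fun l hl => ?_⟩
    · by_contra hG'
      exact absurd hij (not_le.mpr (hlt i ⟨Or.inl ⟨hi.1.1, hG'⟩, hi.1.2⟩))
    · by_cases hlG : ((r l).1, (r l).2.1) ∈ G
      · exact hi.2 l ⟨hlG, hl.2⟩
      · exact hij.trans (hlt l ⟨Or.inr ⟨hl.1, hlG⟩, hl.2⟩).le
  refine ⟨key hj hlt, key (by rwa [Set.inter_comm]) (by rwa [Set.union_comm])⟩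

end Points

end PoissonRace

/-! ### Correlated sampling through densities. -/

section CorrelatedSampling

theorem sub_le_tvDist {Ω : Type*} [MeasurableSpace Ω] (P Q : Measure Ω) {B : Set Ω}
    (hB : MeasurableSet B) : P B - Q B ≤ tvDist P Q :=
  le_iSup₂_of_le B hB le_rfl

theorem tvDist_le_iff {Ω : Type*} [MeasurableSpace Ω] {P Q : Measure Ω} {c : ℝ≥0∞} :
    tvDist P Q ≤ c ↔ ∀ B, MeasurableSet B → P B ≤ Q B + c := by
  simp [tvDist, add_comm c]

theorem tvDist_le_one {Ω : Type*} [MeasurableSpace Ω] (P Q : Measure Ω)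
    [IsProbabilityMeasure P] : tvDist P Q ≤ 1 :=
  tvDist_le_iff.mpr fun _ _ => prob_le_one.trans le_add_self

variable {α H : Type*} [MeasurableSpace α] [MeasurableSpace H] [StandardBorelSpace H]

/-- The region under the graphs of the densities of `A a` with respect to `P`. -/
def densityRegion (A : Kernel α H) (P : Measure H) [IsProbabilityMeasure P] :
    Set (α × (H × ℝ)) :=
  {q | 0 ≤ q.2.2 ∧ ENNReal.ofReal q.2.2 < Kernel.rnDeriv A (Kernel.const α P) q.1 q.2.1}

/-- The section at `a` of the region under the graphs of the densities. -/
def densitySection (A : Kernel α H) (P : Measure H) [IsProbabilityMeasure P] (a : α) :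
    Set (H × ℝ) := {q | (a, q) ∈ densityRegion A P}

/-- The sample from `A a` that is determined by the point process `r`: the first coordinate of
the earliest point under the graph of the density of `A a`. -/
def corrSample (A : Kernel α H) (P : Measure H) [IsProbabilityMeasure P] (a : α)
    (r : ℕ → H × ℝ × ℝ) : H := (firstPoint (densitySection A P a) r).1

variable (A : Kernel α H) (P : Measure H) [IsProbabilityMeasure P]

theorem measurableSet_densityRegion : MeasurableSet (densityRegion A P) := by
  have h := Kernel.measurable_rnDeriv A (Kernel.const α P)
  have h1 : Measurable fun q : α × (H × ℝ) =>
      Kernel.rnDeriv A (Kernel.const α P) q.1 q.2.1 :=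
    h.comp (measurable_fst.prodMk (measurable_fst.comp measurable_snd))
  have h2 : Measurable fun q : α × (H × ℝ) => q.2.2 := by fun_prop
  exact (measurableSet_le measurable_const h2).inter
    (measurableSet_lt h2.ennreal_ofReal h1)

theorem measurableSet_densitySection (a : α) : MeasurableSet (densitySection A P a) :=
  measurable_prodMk_left (measurableSet_densityRegion A P)

theorem measurable_corrSample :
    Measurable fun p : α × (ℕ → H × ℝ × ℝ) => corrSample A P p.1 p.2 :=
  (measurable_firstPoint (measurableSet_densityRegion A P)).fst

variable {A P} [IsMarkovKernel A]

/-- Fubini: the fibre over h is an interval whose length is the density at h, and absolute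
continuity lets the density integrate back to `A a`. -/
theorem prod_densitySection_inter {a : α} (ha : A a ≪ P) {B : Set H} (hB : MeasurableSet B) :
    P.prod lebNonneg (Prod.fst ⁻¹' B ∩ densitySection A P a) = A a B := by
  have hm : MeasurableSet (Prod.fst ⁻¹' B ∩ densitySection A P a) :=
    (measurable_fst hB).inter (measurableSet_densitySection A P a)
  have hf : Measurable fun h => Kernel.rnDeriv A (Kernel.const α P) a h :=
    Kernel.measurable_rnDeriv_right A (Kernel.const α P) a
  rw [Measure.prod_apply hm]
  have hsec (h : H) : lebNonneg (Prod.mk h ⁻¹' (Prod.fst ⁻¹' B ∩ densitySection A P a)) =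
      B.indicator (fun h => Kernel.rnDeriv A (Kernel.const α P) a h) h := by
    by_cases hh : h ∈ B
    · rw [Set.indicator_of_mem hh]
      have h1 : Prod.mk h ⁻¹' (Prod.fst ⁻¹' B ∩ densitySection A P a) =
          {y : ℝ | 0 ≤ y ∧ ENNReal.ofReal y < Kernel.rnDeriv A (Kernel.const α P) a h} := by
        ext y
        simp [densitySection, densityRegion, hh]
      rw [h1]
      generalize Kernel.rnDeriv A (Kernel.const α P) a h = c
      -- The value ∞ of the density is not excluded pointwise; its fibre is a half-line of infinite
      -- length.
      induction c with
      | top =>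
        have : {y : ℝ | 0 ≤ y ∧ ENNReal.ofReal y < ∞} = Set.Ici 0 := by ext; simp
        rw [this, lebNonneg, Measure.restrict_apply measurableSet_Ici, Set.inter_self,
          Real.volume_Ici]
      | coe c =>
        have : {y : ℝ | 0 ≤ y ∧ ENNReal.ofReal y < c} = Set.Ico 0 (c : ℝ) := by
          ext y
          simp only [Set.mem_ofPred_eq, Set.mem_Ico]
          refine and_congr_right fun hy => ?_
          rw [← ENNReal.ofReal_coe_nnreal, ENNReal.ofReal_lt_ofReal_iff_of_nonneg hy]
        rw [this, lebNonneg, Measure.restrict_apply measurableSet_Ico,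
          Set.inter_eq_left.mpr (fun x hx => hx.1), Real.volume_Ico, sub_zero,
          ENNReal.ofReal_coe_nnreal]
    · rw [Set.indicator_of_notMem hh]
      have h1 : Prod.mk h ⁻¹' (Prod.fst ⁻¹' B ∩ densitySection A P a) = ∅ := by
        ext y; simp [hh]
      rw [h1, measure_empty]
  simp_rw [hsec]
  rw [lintegral_indicator hB]
  have h2 := Kernel.withDensity_rnDeriv_eq (κ := A) (η := Kernel.const α P) (a := a)
    (by simpa using ha)
  conv_rhs => rw [← h2]
  rw [Kernel.withDensity_apply' _ (Kernel.measurable_rnDeriv A _)]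
  simp

theorem prod_densitySection {a : α} (ha : A a ≪ P) :
    P.prod lebNonneg (densitySection A P a) = 1 := by
  have h := prod_densitySection_inter ha MeasurableSet.univ
  rwa [Set.preimage_univ, Set.univ_inter, measure_univ] at h

/-- Whatever sticks out of b's region in a's region lies over the set B where the density of `A b`
is smaller, and over B the region of b is inside that of a. So the area sticking out is at most `A a
B - A b B`. -/
theorem one_sub_tvDist_le {a b : α} (ha : A a ≪ P) (hb : A b ≪ P) :
    1 - (tvDist (A a) (A b)).toReal ≤
      (P.prod lebNonneg).real (densitySection A P a ∩ densitySection A P b) := by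
  set f := Kernel.rnDeriv A (Kernel.const α P)
  have hf c : Measurable fun h => f c h := Kernel.measurable_rnDeriv_right A _ c
  let B : Set H := {h | f b h < f a h}
  have hB : MeasurableSet B := measurableSet_lt (hf b) (hf a)
  have hma := measurableSet_densitySection A P a
  have hmb := measurableSet_densitySection A P b
  have h1 := prod_densitySection_inter ha hB
  have h2 := prod_densitySection_inter hb hB
  have fa : P.prod lebNonneg (densitySection A P a) ≠ ∞ := by simp [prod_densitySection ha]
  have e1 := measureReal_inter_add_sdiff (μ := P.prod lebNonneg) (s := densitySection A P a)
    hmb fa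
  have r1 : (P.prod lebNonneg).real (densitySection A P a) = 1 := by
    simp [measureReal_def, prod_densitySection ha]
  have hsub : densitySection A P a \ densitySection A P b ∪
      (Prod.fst ⁻¹' B ∩ densitySection A P b) ⊆ Prod.fst ⁻¹' B ∩ densitySection A P a := by
    rintro ⟨h, y⟩ (⟨hy, hy'⟩ | ⟨hh, hy⟩)
    · refine ⟨?_, hy⟩
      have : ¬ (ENNReal.ofReal y < f b h) := fun hlt => hy' ⟨hy.1, hlt⟩
      exact (not_lt.mp this).trans_lt hy.2
    · exact ⟨hh, hy.1, hy.2.trans hh⟩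
  have hfB : P.prod lebNonneg (Prod.fst ⁻¹' B ∩ densitySection A P a) ≠ ∞ := by
    rw [h1]; exact measure_ne_top _ _
  have hfB' : P.prod lebNonneg (Prod.fst ⁻¹' B ∩ densitySection A P b) ≠ ∞ := by
    rw [h2]; exact measure_ne_top _ _
  have hmono := measureReal_mono (μ := P.prod lebNonneg) hsub hfB
  rw [measureReal_union (by
      rw [Set.disjoint_left]; exact fun x hx hx' => hx.2 hx'.2)
    ((measurable_fst hB).inter hmb)
    (ne_top_of_le_ne_top fa (measure_mono Set.sdiff_subset)) hfB'] at hmono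
  have r2 : (P.prod lebNonneg).real (Prod.fst ⁻¹' B ∩ densitySection A P a) =
      (A a).real B := by simp [measureReal_def, h1]
  have r3 : (P.prod lebNonneg).real (Prod.fst ⁻¹' B ∩ densitySection A P b) =
      (A b).real B := by simp [measureReal_def, h2]
  have htv : (A a).real B - (A b).real B ≤ (tvDist (A a) (A b)).toReal := by
    have h := tsub_le_iff_left.mp (sub_le_tvDist (A a) (A b) hB)
    have hne : tvDist (A a) (A b) ≠ ∞ :=
      ne_top_of_le_ne_top ENNReal.one_ne_top (tvDist_le_one _ _)
    have h' := ENNReal.toReal_mono (by finiteness) h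
    rw [ENNReal.toReal_add (measure_ne_top _ _) hne] at h'
    simp only [measureReal_def]
    linarith
  linarith

variable {R : Measure (ℕ → H × ℝ × ℝ)}

omit [IsMarkovKernel A] in
theorem measurable_corrSample_right (a : α) : Measurable (corrSample A P a) :=
  (measurable_corrSample A P).comp measurable_prodMk_left

theorem map_corrSample (hR : IsPoissonPointProcess R (poissonIntensity P)) {a : α}
    (ha : A a ≪ P) : R.map (corrSample A P a) = A a := by
  have hm := measurable_firstPoint_right (measurableSet_densitySection A P a)
  have h := hR.map_firstPoint (measurableSet_densitySection A P a) (prod_densitySection ha)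
  have h2 : R.map (corrSample A P a) =
      (R.map (firstPoint (densitySection A P a))).map Prod.fst := by
    rw [Measure.map_map measurable_fst hm]; rfl
  ext B hB
  rw [h2, h, Measure.map_apply measurable_fst hB, Measure.restrict_apply (measurable_fst hB),
    prod_densitySection_inter ha hB]

/-- Both regions have area 1 and their overlap c is at least 1 - d, so intersection over union,
c/(2-c), is at least (1-d)/(1+d). -/
theorem prob_corrSample_ne_le (hR : IsPoissonPointProcess R (poissonIntensity P)) {a b : α}
    (ha : A a ≪ P) (hb : A b ≪ P) :
    R.real {r | corrSample A P a r ≠ corrSample A P b r} ≤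
      2 * (tvDist (A a) (A b)).toReal / (1 + (tvDist (A a) (A b)).toReal) := by
  have := hR.isProbabilityMeasure
  set d := (tvDist (A a) (A b)).toReal
  have hd0 : 0 ≤ d := ENNReal.toReal_nonneg
  have h1 := hR.le_firstPoint_eq (measurableSet_densitySection A P a)
    (measurableSet_densitySection A P b) (prod_densitySection ha) (prod_densitySection hb)
  have h2 := one_sub_tvDist_le ha hb
  set c := (P.prod lebNonneg).real (densitySection A P a ∩ densitySection A P b)
  have hc : c ≤ 1 := by
    have : P.prod lebNonneg (densitySection A P a ∩ densitySection A P b) ≤ 1 :=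
      (measure_mono Set.inter_subset_left).trans (prod_densitySection ha).le
    exact ENNReal.toReal_le_of_le_ofReal zero_le_one (by simpa using this)
  have hm : MeasurableSet {r | corrSample A P a r = corrSample A P b r} :=
    measurableSet_eq_fun (measurable_corrSample_right a) (measurable_corrSample_right b)
  have h3 : R.real {r | firstPoint (densitySection A P a) r =
      firstPoint (densitySection A P b) r} ≤
      R.real {r | corrSample A P a r = corrSample A P b r} :=
    measureReal_mono fun r hr => congrArg Prod.fst hr
  have h4 : {r | corrSample A P a r ≠ corrSample A P b r} =
      {r | corrSample A P a r = corrSample A P b r}ᶜ := rfl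
  rw [h4, probReal_compl_eq_one_sub hm]
  have h5 : (1 - d) / (1 + d) ≤ c / (2 - c) := by
    rw [div_le_div_iff₀ (by linarith) (by linarith)]
    nlinarith
  have h6 : 2 * d / (1 + d) = 1 - (1 - d) / (1 + d) := by
    have : 1 + d ≠ 0 := by positivity
    field_simp; ring
  rw [h6]
  linarith

/-- A number in the unit interval that is determined by the point process `r`. -/
def uniformOf (r : ℕ → H × ℝ × ℝ) : unitInterval :=
  Set.projIcc 0 1 zero_le_one (firstPoint (Set.univ ×ˢ Set.Icc 0 1) r).2

omit [StandardBorelSpace H] in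
theorem measurable_uniformOf : Measurable (uniformOf (H := H)) :=
  continuous_projIcc.measurable.comp
    (measurable_firstPoint_right (MeasurableSet.univ.prod measurableSet_Icc)).snd

omit [StandardBorelSpace H] in
-- The earliest point over H × [0,1] has law P times Lebesgue measure, so its second coordinate is
-- uniform. Thus the Poisson process also supplies the real-valued randomness of the selection.
theorem map_uniformOf (hR : IsPoissonPointProcess R (poissonIntensity P)) :
    R.map uniformOf = volume := by
  have hG : MeasurableSet (Set.univ ×ˢ Set.Icc 0 1 : Set (H × ℝ)) :=
    MeasurableSet.univ.prod measurableSet_Icc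
  have hleb : lebNonneg.restrict (Set.Icc 0 1) = volume.restrict (Set.Icc (0 : ℝ) 1) := by
    rw [lebNonneg, Measure.restrict_restrict measurableSet_Icc,
      Set.inter_eq_left.mpr (fun x hx => hx.1)]
  have h := hR.map_firstPoint hG (by
    rw [Measure.prod_prod, measure_univ, one_mul, ← Measure.restrict_apply_univ, hleb]; simp)
  rw [← Measure.prod_restrict, hleb, Measure.restrict_univ] at h
  have hm := measurable_firstPoint_right hG
  have h2 : R.map uniformOf = (((R.map (firstPoint (Set.univ ×ˢ Set.Icc 0 1))).map
      Prod.snd).map (Set.projIcc 0 1 zero_le_one) : Measure unitInterval) := by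
    rw [Measure.map_map measurable_snd hm, Measure.map_map continuous_projIcc.measurable
      (measurable_snd.comp hm)]
    rfl
  rw [h2, h, Measure.map_snd_prod, measure_univ, one_smul,
    ← map_comap_subtype_coe measurableSet_Icc,
    Measure.map_map continuous_projIcc.measurable measurable_subtype_coe]
  have : (Set.projIcc (0 : ℝ) 1 zero_le_one) ∘ Subtype.val = id := by
    ext x; simp
  rw [this, Measure.map_id]
  rfl

end CorrelatedSampling

/-! ### Frequent accurate outputs. -/

section HeavyHitters

/-- If `F a r` and `F b r` are rarely different, and `F a r` is rarely in `V`, then, for `r` in a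
set of substantial probability, some point outside `V` is frequently a value of `F · r`. -/
theorem exists_heavy_hitter {α Ω H : Type*} [MeasurableSpace α] [MeasurableSpace Ω]
    [MeasurableSpace H] [StandardBorelSpace H] {μ : Measure α} [IsProbabilityMeasure μ]
    {R : Measure Ω} [IsProbabilityMeasure R] {F : α → Ω → H}
    (hF : Measurable fun p : α × Ω => F p.1 p.2) {V : Set H} (hV : MeasurableSet V)
    {η β : ℝ} (hη : η ∈ Set.Ioo (0 : ℝ) 1) (hβ : 0 ≤ β)
    (hne : ∫⁻ a, ∫⁻ b, R {r | F a r ≠ F b r} ∂μ ∂μ ≤ ENNReal.ofReal η)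
    (hbad : ∫⁻ a, R {r | F a r ∈ V} ∂μ ≤ ENNReal.ofReal β)
    (hgap : β < (1 - √η) ^ 2) :
    ∃ N : Set Ω, MeasurableSet N ∧ R N ≤ ENNReal.ofReal (1 - ((1 - √η) ^ 2 - β)) ∧
      ∀ r ∉ N, ∃ h, h ∉ V ∧ 1 - √η ≤ μ.real {a | F a r = h} := by
  have hs0 : 0 < √η := Real.sqrt_pos.mpr hη.1
  have hs1 : √η < 1 := by rw [Real.sqrt_lt' one_pos]; simpa using hη.2
  set s := 1 - √η with hs
  have hspos : 0 < s := by linarith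
  have hm1 : MeasurableSet {p : Ω × (α × α) | F p.2.1 p.1 ≠ F p.2.2 p.1} := by
    refine (measurableSet_eq_fun (f := fun p : Ω × (α × α) => F p.2.1 p.1)
      (g := fun p => F p.2.2 p.1) ?_ ?_).compl
    · exact hF.comp (measurable_snd.fst.prodMk measurable_fst)
    · exact hF.comp (measurable_snd.snd.prodMk measurable_fst)
  have hm2 : MeasurableSet {p : Ω × α | F p.2 p.1 ∈ V} :=
    (hF.comp measurable_swap) hV
  let q : Ω → ℝ≥0∞ := fun r => (μ.prod μ) {p | F p.1 r ≠ F p.2 r}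
  let b : Ω → ℝ≥0∞ := fun r => μ {a | F a r ∈ V}
  have hq : Measurable q := measurable_measure_prodMk_left hm1
  have hb : Measurable b := measurable_measure_prodMk_left hm2
  have hqi : ∫⁻ r, q r ∂ R ≤ ENNReal.ofReal η := by
    refine le_trans (le_of_eq ?_) hne
    calc ∫⁻ r, q r ∂ R = (R.prod (μ.prod μ)) {p | F p.2.1 p.1 ≠ F p.2.2 p.1} :=
          (Measure.prod_apply hm1).symm
      _ = ∫⁻ p, R {r | F p.1 r ≠ F p.2 r} ∂(μ.prod μ) := Measure.prod_apply_symm hm1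
      _ = _ := lintegral_prod _ (measurable_measure_prodMk_right hm1).aemeasurable
  have hbi : ∫⁻ r, b r ∂ R ≤ ENNReal.ofReal β := by
    refine le_trans (le_of_eq ?_) hbad
    calc ∫⁻ r, b r ∂ R = (R.prod μ) {p | F p.2 p.1 ∈ V} := (Measure.prod_apply hm2).symm
      _ = _ := Measure.prod_apply_symm hm2
  -- The exceptional strings: disagreement at least √η, which has probability at most η/√η = √η by
  -- Markov, or mass of bad outputs at least s = 1 - √η.
  refine ⟨{r | ENNReal.ofReal √η ≤ q r} ∪ {r | ENNReal.ofReal s ≤ b r},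
    (measurableSet_le measurable_const hq).union (measurableSet_le measurable_const hb), ?_, ?_⟩
  · have h1 : R {r | ENNReal.ofReal √η ≤ q r} ≤ ENNReal.ofReal √η := by
      refine (meas_ge_le_lintegral_div hq.aemeasurable (by simpa using hη.1) (by simp)).trans ?_
      refine (ENNReal.div_le_div_right hqi _).trans ?_
      rw [← ENNReal.ofReal_div_of_pos hs0, Real.div_sqrt]
    have h2 : R {r | ENNReal.ofReal s ≤ b r} ≤ ENNReal.ofReal (β / s) := by
      refine (meas_ge_le_lintegral_div hb.aemeasurable (by simpa using hspos) (by simp)).trans ?_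
      refine (ENNReal.div_le_div_right hbi _).trans ?_
      rw [← ENNReal.ofReal_div_of_pos hspos]
    refine (measure_union_le _ _).trans ((add_le_add h1 h2).trans ?_)
    rw [← ENNReal.ofReal_add hs0.le (by positivity)]
    refine ENNReal.ofReal_le_ofReal ?_
    -- Equivalent to β(1 - s) ≤ s²(1 - s), hence a consequence of β < s².
    have h3 : β / s ≤ s - (s ^ 2 - β) := by
      rw [div_le_iff₀ hspos]
      nlinarith
    linarith
  · intro r hr
    simp only [Set.mem_union, Set.mem_ofPred_eq, not_or, not_le] at hr
    obtain ⟨hr1, hr2⟩ := hr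
    have hFr : Measurable fun a => F a r := hF.comp measurable_prodMk_right
    -- If all level sets had mass below s, every a would disagree with more than √η of the points,
    -- against `hr1`.
    have hex : ∃ a, s ≤ μ.real {c | F c r = F a r} := by
      by_contra! hcon
      refine absurd hr1 (not_lt.mpr ?_)
      have hm3 : MeasurableSet {p : α × α | F p.1 r ≠ F p.2 r} := measurable_prodMk_left hm1
      change _ ≤ (μ.prod μ) {p | F p.1 r ≠ F p.2 r}
      rw [Measure.prod_apply hm3]
      calc ENNReal.ofReal √η = ∫⁻ _, ENNReal.ofReal √η ∂μ := by simp
        _ ≤ _ := by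
          refine lintegral_mono fun a => ?_
          have h4 : MeasurableSet {c | F c r = F a r} :=
            measurableSet_eq_fun hFr measurable_const
          have h5 : Prod.mk a ⁻¹' {p : α × α | F p.1 r ≠ F p.2 r} = {c | F c r = F a r}ᶜ := by
            ext c; exact ne_comm
          rw [h5, ← ofReal_measureReal, probReal_compl_eq_one_sub h4]
          refine ENNReal.ofReal_le_ofReal ?_
          have := hcon a
          linarith
    obtain ⟨a, ha⟩ := hex
    -- If this value lay in V, its level set, of mass at least s, would be counted in `b r`, which
    -- is below s.
    refine ⟨F a r, fun hmem => ?_, ha⟩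
    have h6 : μ {c | F c r = F a r} ≤ b r :=
      measure_mono fun c hc => by
        simp only [Set.mem_ofPred_eq] at hc ⊢
        rwa [hc]
    have h7 := ENNReal.ofReal_le_ofReal ha
    rw [ofReal_measureReal] at h7
    exact absurd (h7.trans h6) (not_le.mpr hr2)

/-- The right side is the tangent at d = ρ of the concave function 2d/(1+d). A linear majorant does
the work of Jensen's inequality and requires no measurability of the total variation distance. -/
theorem two_mul_div_one_add_le {d ρ : ℝ} (hd : 0 ≤ d) (hρ : 0 < ρ) :
    2 * d / (1 + d) ≤ 2 * ρ ^ 2 / (1 + ρ) ^ 2 + 2 / (1 + ρ) ^ 2 * d := by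
  have : 2 * ρ ^ 2 / (1 + ρ) ^ 2 + 2 / (1 + ρ) ^ 2 * d =
      (2 * ρ ^ 2 + 2 * d) / (1 + ρ) ^ 2 := by ring
  rw [this, div_le_div_iff₀ (by positivity) (by positivity)]
  nlinarith [sq_nonneg (d - ρ)]

variable {X : Type*} [MeasurableSpace X] {H : Set (X → Bool)} {n : ℕ}

instance (D : Measure (X × Bool)) [IsProbabilityMeasure D] (n : ℕ) :
    IsProbabilityMeasure (sampleLaw D n) := by unfold sampleLaw; infer_instance

theorem measurableSet_misclassified
    (heval : Measurable fun p : H × X => (p.1 : X → Bool) p.2) :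
    MeasurableSet {p : H × (X × Bool) | (p.1 : X → Bool) p.2.1 ≠ p.2.2} :=
  (measurableSet_eq_fun (f := fun p : H × (X × Bool) => (p.1 : X → Bool) p.2.1)
    (g := fun p => p.2.2)
    (heval.comp (measurable_fst.prodMk measurable_snd.fst)) measurable_snd.snd).compl

theorem measurable_err (heval : Measurable fun p : H × X => (p.1 : X → Bool) p.2)
    (D : Measure (X × Bool)) [IsProbabilityMeasure D] :
    Measurable fun h : H => err D h :=
  (measurable_measure_prodMk_left (ν := D) (measurableSet_misclassified heval)).ennreal_toReal

variable [StandardBorelSpace H]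

/-- For random strings `r` in a set of substantial probability, some accurate classifier is
frequently the output of the correlated sample from the learning rule. -/
theorem exists_accurate_heavy_hitter
    (heval : Measurable fun p : H × X => (p.1 : X → Bool) p.2)
    {P : Measure H} [IsProbabilityMeasure P] {R : Measure (ℕ → H × ℝ × ℝ)}
    (hR : IsPoissonPointProcess R (poissonIntensity P))
    {A : Kernel (Sample X n) H} [IsMarkovKernel A] {ρ α β : ℝ} (hρ : ρ ∈ Set.Ioo (0 : ℝ) 1)
    (hβ : 0 ≤ β) (hgap : β < (1 - √(2 * ρ / (ρ + 1))) ^ 2)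
    {D : Measure (X × Bool)} [IsProbabilityMeasure D]
    (hTV : IsTVIndistinguishable A D ρ) (hacc : IsAccurate A D α β) (hac : IsAbsContOn A P D) :
    ∃ N : Set (ℕ → H × ℝ × ℝ), MeasurableSet N ∧
      R N ≤ ENNReal.ofReal (1 - ((1 - √(2 * ρ / (ρ + 1))) ^ 2 - β)) ∧
      ∀ r ∉ N, ∃ h : H, err D h ≤ α ∧
        1 - √(2 * ρ / (ρ + 1)) ≤ (sampleLaw D n).real {S | corrSample A P S r = h} := by
  have := hR.isProbabilityMeasure
  have hρ0 := hρ.1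
  have hη : 2 * ρ / (ρ + 1) ∈ Set.Ioo (0 : ℝ) 1 := by
    refine ⟨by positivity, ?_⟩
    rw [div_lt_one (by positivity)]
    linarith [hρ.2]
  have hV : MeasurableSet {h : H | α < err D h} :=
    measurableSet_lt measurable_const (measurable_err heval D)
  have hne : ∫⁻ S, ∫⁻ S', R {r | corrSample A P S r ≠ corrSample A P S' r}
      ∂(sampleLaw D n) ∂(sampleLaw D n) ≤ ENNReal.ofReal (2 * ρ / (ρ + 1)) := by
    calc _ ≤ ∫⁻ S, ∫⁻ S', (ENNReal.ofReal (2 * ρ ^ 2 / (1 + ρ) ^ 2) +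
          ENNReal.ofReal (2 / (1 + ρ) ^ 2) * tvDist (A S) (A S'))
            ∂(sampleLaw D n) ∂(sampleLaw D n) := by
          refine lintegral_mono_ae ?_
          filter_upwards [hac] with S hS
          refine lintegral_mono_ae ?_
          filter_upwards [hac] with S' hS'
          have hne : tvDist (A S) (A S') ≠ ∞ :=
            ne_top_of_le_ne_top ENNReal.one_ne_top (tvDist_le_one _ _)
          have h := (prob_corrSample_ne_le hR hS hS').trans
            (two_mul_div_one_add_le ENNReal.toReal_nonneg hρ0)
          rw [← ofReal_measureReal]
          refine (ENNReal.ofReal_le_ofReal h).trans ?_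
          rw [ENNReal.ofReal_add (by positivity) (by positivity),
            ENNReal.ofReal_mul (by positivity), ENNReal.ofReal_toReal hne]
      _ ≤ ENNReal.ofReal (2 * ρ ^ 2 / (1 + ρ) ^ 2) +
          ENNReal.ofReal (2 / (1 + ρ) ^ 2) * ENNReal.ofReal ρ := by
          simp_rw [lintegral_add_left measurable_const,
            lintegral_const_mul' _ _ ENNReal.ofReal_ne_top, lintegral_const, measure_univ,
            mul_one]
          gcongr
          exact hTV
      _ = ENNReal.ofReal (2 * ρ / (ρ + 1)) := by
          rw [← ENNReal.ofReal_mul (by positivity),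
            ← ENNReal.ofReal_add (by positivity) (by positivity)]
          congr 1
          field_simp
          ring
  have hbad : ∫⁻ S, R {r | corrSample A P S r ∈ {h : H | α < err D h}} ∂(sampleLaw D n) ≤
      ENNReal.ofReal β := by
    refine le_trans (le_of_eq ?_) hacc
    refine lintegral_congr_ae ?_
    filter_upwards [hac] with S hS
    rw [← map_corrSample hR hS, Measure.map_apply (measurable_corrSample_right S) hV]
    rfl
  obtain ⟨N, hN, hRN, hgood⟩ := exists_heavy_hitter (measurable_corrSample A P) hV hη hβ hne
    hbad hgap
  refine ⟨N, hN, hRN, fun r hr => ?_⟩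
  obtain ⟨h, hh, hs⟩ := hgood r hr
  exact ⟨h, not_lt.mp hh, hs⟩

end HeavyHitters

/-! ### Concentration of frequencies. -/

section Concentration

variable {Y : Type*}

/-- The fraction of the entries of `ω` that lie in `U`. -/
def freq {m : ℕ} (U : Set Y) (ω : Fin m → Y) : ℝ := (∑ j, U.indicator 1 (ω j)) / m

theorem indicator_one_nonneg (U : Set Y) (y : Y) : 0 ≤ U.indicator (1 : Y → ℝ) y :=
  Set.indicator_nonneg (fun _ _ => zero_le_one) y

theorem indicator_one_le (U : Set Y) (y : Y) : U.indicator (1 : Y → ℝ) y ≤ 1 :=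
  Set.indicator_le_self' (fun _ _ => zero_le_one) y

theorem freq_nonneg {m : ℕ} (U : Set Y) (ω : Fin m → Y) : 0 ≤ freq U ω :=
  div_nonneg (Finset.sum_nonneg fun _ _ => indicator_one_nonneg _ _) (Nat.cast_nonneg m)

theorem freq_le_one {m : ℕ} (U : Set Y) (ω : Fin m → Y) : freq U ω ≤ 1 := by
  refine div_le_one_of_le₀ ?_ (Nat.cast_nonneg m)
  refine (Finset.sum_le_sum fun j _ => indicator_one_le U (ω j)).trans ?_
  simp

/-- The longer frequency is a convex combination of the shorter one and one indicator, the latter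
with weight 1/(m+1). -/
theorem abs_freq_succ_sub_le {m : ℕ} (U : Set Y) (ω : Fin (m + 1) → Y) (j : Fin (m + 1)) :
    |freq U ω - freq U (fun l => ω (j.succAbove l))| ≤ 1 / (m + 1 : ℕ) := by
  have h0 := freq_nonneg U (fun l => ω (j.succAbove l))
  have h1 := freq_le_one U (fun l => ω (j.succAbove l))
  have hs : ∑ l, U.indicator (1 : Y → ℝ) (ω (j.succAbove l)) =
      m * freq U (fun l => ω (j.succAbove l)) := by
    rcases Nat.eq_zero_or_pos m with rfl | hm
    · simp
    · rw [freq]; field_simp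
  have h2 : freq U ω = (U.indicator 1 (ω j) + m * freq U (fun l => ω (j.succAbove l))) /
      (m + 1 : ℕ) := by
    conv_lhs => rw [freq, Fin.sum_univ_succAbove _ j, hs]
  have i0 := indicator_one_nonneg U (ω j)
  have i1 := indicator_one_le U (ω j)
  have h3 : freq U ω - freq U (fun l => ω (j.succAbove l)) =
      (U.indicator 1 (ω j) - freq U (fun l => ω (j.succAbove l))) / (m + 1 : ℕ) := by
    rw [h2]; push_cast; field_simp; ring
  rw [h3, abs_div, abs_of_pos (by positivity : (0 : ℝ) < (m + 1 : ℕ))]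
  gcongr
  exact abs_le.mpr ⟨by linarith, by linarith⟩

variable [MeasurableSpace Y] {Q : Measure Y} [IsProbabilityMeasure Q]

/-- Hoeffding's inequality for the frequency of a set. -/
theorem prob_freq_dev_le {m : ℕ} {U : Set Y} (hU : MeasurableSet U) {δ : ℝ} (hδ : 0 ≤ δ) :
    Measure.pi (fun _ : Fin m => Q) {ω | δ < |freq U ω - Q.real U|} ≤
      ENNReal.ofReal (2 * Real.exp (-(2 * m * δ ^ 2))) := by
  rcases Nat.eq_zero_or_pos m with rfl | hm
  · refine prob_le_one.trans ?_
    rw [← ENNReal.ofReal_one]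
    refine ENNReal.ofReal_le_ofReal ?_
    simp
  set μ := Measure.pi (fun _ : Fin m => Q)
  have hmR : (0 : ℝ) < m := by exact_mod_cast hm
  let Z : Y → ℝ := fun y => U.indicator 1 y - Q.real U
  have hind : Measurable (U.indicator (1 : Y → ℝ)) := measurable_one.indicator hU
  have hZ : Measurable Z := hind.sub_const _
  have hsub : HasSubgaussianMGF Z ((1 / 2) ^ 2) Q := by
    have h := hasSubgaussianMGF_of_mem_Icc (μ := Q) (X := U.indicator 1) (a := 0) (b := 1)
      hind.aemeasurable (ae_of_all _ fun y => ⟨indicator_one_nonneg U y, indicator_one_le U y⟩)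
    rw [integral_indicator_one hU] at h
    simpa using h
  have hcomp (f : Y → ℝ) (hf : Measurable f) (hs : HasSubgaussianMGF f ((1 / 2) ^ 2) Q)
      (j : Fin m) : HasSubgaussianMGF (fun ω : Fin m → Y => f (ω j)) ((1 / 2) ^ 2) μ := by
    refine HasSubgaussianMGF.of_map (Y := fun ω : Fin m → Y => ω j) (X := f)
      (measurable_pi_apply j).aemeasurable ?_
    rwa [(measurePreserving_eval (fun _ : Fin m => Q) j).map_eq]
  have htail (f : Y → ℝ) (hf : Measurable f) (hs : HasSubgaussianMGF f ((1 / 2) ^ 2) Q) :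
      μ.real {ω | m * δ ≤ ∑ j, f (ω j)} ≤ Real.exp (-(2 * m * δ ^ 2)) := by
    have hi : iIndepFun (fun j (ω : Fin m → Y) => f (ω j)) μ :=
      iIndepFun_pi (X := fun _ => f) fun _ => hf.aemeasurable
    have h := HasSubgaussianMGF.measure_sum_ge_le_of_iIndepFun hi (s := Finset.univ)
      (fun j _ => hcomp f hf hs j) (ε := m * δ) (by positivity)
    refine h.trans (le_of_eq ?_)
    congr 1
    simp
    field_simp
  have hfreq (ω : Fin m → Y) : m * (freq U ω - Q.real U) = ∑ j, Z (ω j) := by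
    simp only [Z, Finset.sum_sub_distrib, freq]
    simp
    field_simp
  have hsubset : {ω | δ < |freq U ω - Q.real U|} ⊆
      {ω : Fin m → Y | m * δ ≤ ∑ j, Z (ω j)} ∪ {ω | m * δ ≤ ∑ j, -Z (ω j)} := by
    intro ω hω
    rcases lt_abs.mp (show δ < |freq U ω - Q.real U| from hω) with h | h
    · left
      change m * δ ≤ _
      rw [← hfreq]
      gcongr
    · right
      change m * δ ≤ _
      rw [Finset.sum_neg_distrib, ← hfreq, ← mul_neg]
      gcongr
  refine (measure_mono hsubset).trans ((measure_union_le _ _).trans ?_)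
  rw [two_mul (Real.exp _), ENNReal.ofReal_add (Real.exp_pos _).le (Real.exp_pos _).le,
    ← ofReal_measureReal, ← ofReal_measureReal]
  exact add_le_add (ENNReal.ofReal_le_ofReal (htail Z hZ hsub))
    (ENNReal.ofReal_le_ofReal (htail (fun y => -Z y) hZ.neg hsub.neg))

theorem measurable_freq_section {α : Type*} [MeasurableSpace α] {m : ℕ} {W : Set (α × Y)}
    (hW : MeasurableSet W) :
    Measurable fun p : α × (Fin m → Y) => freq (Prod.mk p.1 ⁻¹' W) p.2 := by
  refine Measurable.div_const ?_ _
  refine Finset.measurable_sum _ fun j _ => ?_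
  have h : Measurable fun p : α × (Fin m → Y) => W.indicator (1 : α × Y → ℝ) (p.1, p.2 j) :=
    (measurable_one.indicator hW).comp (by fun_prop)
  exact h

theorem measurableSet_freq_dev {m : ℕ} {W : Set (Y × Y)} (hW : MeasurableSet W) (δ : ℝ) :
    MeasurableSet {p : Y × (Fin m → Y) |
      δ < |freq (Prod.mk p.1 ⁻¹' W) p.2 - Q.real (Prod.mk p.1 ⁻¹' W)|} := by
  have h1 : Measurable fun p : Y × (Fin m → Y) => Q.real (Prod.mk p.1 ⁻¹' W) :=
    (measurable_measure_prodMk_left hW).ennreal_toReal.comp measurable_fst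
  exact measurableSet_lt measurable_const
    (continuous_abs.measurable.comp ((measurable_freq_section hW).sub h1))

theorem prod_freq_dev_le {m : ℕ} {W : Set (Y × Y)} (hW : MeasurableSet W) {δ : ℝ}
    (hδ : 0 ≤ δ) :
    (Q.prod (Measure.pi fun _ : Fin m => Q)) {p : Y × (Fin m → Y) |
      δ < |freq (Prod.mk p.1 ⁻¹' W) p.2 - Q.real (Prod.mk p.1 ⁻¹' W)|} ≤
      ENNReal.ofReal (2 * Real.exp (-(2 * m * δ ^ 2))) := by
  rw [Measure.prod_apply (measurableSet_freq_dev hW δ)]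
  calc _ ≤ ∫⁻ _, ENNReal.ofReal (2 * Real.exp (-(2 * m * δ ^ 2))) ∂Q :=
        lintegral_mono fun x => prob_freq_dev_le (measurable_prodMk_left hW) hδ
    _ = _ := by simp

/-- Frequencies of sets that are determined by an entry of an independent sample. -/
theorem prob_freq_dev_cross_le {m : ℕ} {W : Set (Y × Y)} (hW : MeasurableSet W) {δ : ℝ}
    (hδ : 0 ≤ δ) (j : Fin m) :
    ((Measure.pi fun _ : Fin m => Q).prod (Measure.pi fun _ : Fin m => Q))
      {p | δ < |freq (Prod.mk (p.1 j) ⁻¹' W) p.2 - Q.real (Prod.mk (p.1 j) ⁻¹' W)|} ≤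
      ENNReal.ofReal (2 * Real.exp (-(2 * m * δ ^ 2))) := by
  have hmp := (measurePreserving_eval (fun _ : Fin m => Q) j).prod
    (MeasurePreserving.id (Measure.pi fun _ : Fin m => Q))
  have h := hmp.measure_preimage (measurableSet_freq_dev (Q := Q) hW δ).nullMeasurableSet
  exact (le_of_eq h).trans (prod_freq_dev_le hW hδ)

/-- Frequencies of sets that are determined by an entry of the sample itself. -/
theorem prob_freq_dev_own_le {m : ℕ} {W : Set (Y × Y)} (hW : MeasurableSet W) {δ : ℝ}
    (hδ : 0 ≤ δ) (hm : 1 / (m : ℝ) ≤ δ / 2) (j : Fin m) :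
    (Measure.pi fun _ : Fin m => Q)
      {ω | δ < |freq (Prod.mk (ω j) ⁻¹' W) ω - Q.real (Prod.mk (ω j) ⁻¹' W)|} ≤
      ENNReal.ofReal (2 * Real.exp (-((m - 1) * δ ^ 2 / 2))) := by
  -- Once entry j is deleted, the remaining ones are independent of the set it determines. The
  -- deletion costs 1/m ≤ δ/2, and Hoeffding's bound for m - 1 entries at δ/2 has exponent (m -
  -- 1)δ²/2.
  obtain ⟨m, rfl⟩ : ∃ l, m = l + 1 := ⟨m - 1, by have := j.pos; omega⟩
  have hmp := measurePreserving_piFinSuccAbove (fun _ : Fin (m + 1) => Q) j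
  have h := hmp.measure_preimage (measurableSet_freq_dev (Q := Q) hW (δ / 2)).nullMeasurableSet
  refine (measure_mono ?_).trans ((le_of_eq h).trans ((prod_freq_dev_le hW
    (by positivity)).trans (le_of_eq ?_)))
  · intro ω hω
    have h1 := abs_freq_succ_sub_le (Prod.mk (ω j) ⁻¹' W) ω j
    change δ / 2 < |freq (Prod.mk (ω j) ⁻¹' W) (fun l => ω (j.succAbove l)) -
      Q.real (Prod.mk (ω j) ⁻¹' W)|
    have h2 : δ < |freq (Prod.mk (ω j) ⁻¹' W) ω - Q.real (Prod.mk (ω j) ⁻¹' W)| := hω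
    have h3 := abs_sub_le (freq (Prod.mk (ω j) ⁻¹' W) ω)
      (freq (Prod.mk (ω j) ⁻¹' W) (fun l => ω (j.succAbove l)))
      (Q.real (Prod.mk (ω j) ⁻¹' W))
    linarith
  · congr 3
    push_cast
    ring

end Concentration

/-! ### The exponential selection rule and its stability. -/

section Selection

open Classical in
-- Both sums are grouped by value; values that c misses only add nonnegative terms on the right.
theorem sum_comp_le_of_fiber_le {κ C : Type*} [Fintype κ] (c c' : κ → C) (f f' : C → ℝ)
    (hf' : ∀ h, 0 ≤ f' h)
    (hle : ∀ j, (Finset.univ.filter fun l => c l = c j).card * f (c j) ≤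
      (Finset.univ.filter fun l => c' l = c j).card * f' (c j)) :
    ∑ j, f (c j) ≤ ∑ j, f' (c' j) := by
  rw [Finset.sum_comp f c, Finset.sum_comp f' c']
  calc _ ≤ ∑ b ∈ Finset.univ.image c, (Finset.univ.filter fun l => c' l = b).card • f' b := by
        refine Finset.sum_le_sum fun b hb => ?_
        obtain ⟨j, -, rfl⟩ := Finset.mem_image.mp hb
        simpa using hle j
    _ ≤ ∑ b ∈ Finset.univ.image c ∪ Finset.univ.image c',
          (Finset.univ.filter fun l => c' l = b).card • f' b :=
        Finset.sum_le_sum_of_subset_of_nonneg Finset.subset_union_left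
          fun b _ _ => nsmul_nonneg (hf' b) _
    _ = _ := by
        symm
        refine Finset.sum_subset Finset.subset_union_right fun b _ hb => ?_
        rw [Finset.filter_eq_empty_iff.mpr, Finset.card_empty, zero_smul]
        intro l _ hl
        exact hb (Finset.mem_image.mpr ⟨l, Finset.mem_univ l, hl⟩)

/-- The score of a classifier with frequency `p` and empirical error `e`. -/
def score (s α ε lam p e : ℝ) : ℝ :=
  lam * (4 * min (p / s) 1 - min (max ((e - α) / ε) 0) 1)

theorem abs_min_one_sub_le (a b : ℝ) : |min a 1 - min b 1| ≤ |a - b| := by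
  have := abs_min_sub_min_le_max a 1 b 1
  simpa using this

theorem abs_clip_sub_le (a b : ℝ) : |min (max a 0) 1 - min (max b 0) 1| ≤ |a - b| := by
  refine (abs_min_one_sub_le _ _).trans ?_
  have := abs_max_sub_max_le_max a 0 b 0
  simpa using this

/-- Clipping is 1-Lipschitz, so the score is Lipschitz in p and e with constants 4 lam/s and lam/ε.
-/
theorem score_sub_le {s α ε lam p e p' e' δ : ℝ} (hs : 0 < s) (hε : 0 < ε) (hlam : 0 ≤ lam)
    (hp : |p - p'| ≤ 2 * δ) (he : |e - e'| ≤ 2 * δ) :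
    score s α ε lam p e ≤ score s α ε lam p' e' + lam * (8 * δ / s + 2 * δ / ε) := by
  have h1 := (abs_le.mp (abs_min_one_sub_le (p / s) (p' / s))).2
  have h2 := (abs_le.mp (abs_clip_sub_le ((e - α) / ε) ((e' - α) / ε))).1
  have h3 : |p / s - p' / s| ≤ 2 * δ / s := by
    rw [← sub_div, abs_div, abs_of_pos hs]; gcongr
  have h4 : |(e - α) / ε - (e' - α) / ε| ≤ 2 * δ / ε := by
    rw [← sub_div, abs_div, abs_of_pos hε, sub_sub_sub_cancel_right]; gcongr
  rw [score, score, ← mul_add]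
  refine mul_le_mul_of_nonneg_left ?_ hlam
  have h5 : 8 * δ / s = 4 * (2 * δ / s) := by ring
  rw [h5]
  linarith

variable {Y H : Type*} {k m : ℕ}

/-- The unnormalized probability of a classifier `h` that is produced by the `i`-th map. -/
def weight (F : Fin k → Y → H) (mis : H → Set Y) (s α ε lam : ℝ) (ω : Fin m → Y) (i : Fin k)
    (h : H) : ℝ :=
  Real.exp (score s α ε lam (freq {y | F i y = h} ω) (freq (mis h) ω))

/-- The total weight of the candidates `F i (ω j)` that lie in `B`. -/
def weightSum (F : Fin k → Y → H) (mis : H → Set Y) (s α ε lam : ℝ) (ω : Fin m → Y)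
    (B : Set H) : ℝ :=
  ∑ i, ∑ j, B.indicator (weight F mis s α ε lam ω i) (F i (ω j))

/-- Some candidate has frequency almost `s` and empirical error at most `α` up to `δ`. -/
def Anchored (F : Fin k → Y → H) (mis : H → Set Y) (s α δ : ℝ) (ω : Fin m → Y) : Prop :=
  ∃ i j, s - δ ≤ freq {y | F i y = F i (ω j)} ω ∧ freq (mis (F i (ω j))) ω ≤ α + δ

/-- The frequencies and the empirical errors of the candidates of `ω` are, up to `2 δ`, the same
in `ω` and in `ω'`. -/
def Matched (F : Fin k → Y → H) (mis : H → Set Y) (δ : ℝ) (ω ω' : Fin m → Y) : Prop :=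
  ∀ i j, |freq {y | F i y = F i (ω j)} ω - freq {y | F i y = F i (ω j)} ω'| ≤ 2 * δ ∧
    |freq (mis (F i (ω j))) ω - freq (mis (F i (ω j))) ω'| ≤ 2 * δ

theorem weight_pos (F : Fin k → Y → H) (mis : H → Set Y) (s α ε lam : ℝ) (ω : Fin m → Y)
    (i : Fin k) (h : H) : 0 < weight F mis s α ε lam ω i h := Real.exp_pos _

variable {F : Fin k → Y → H} {mis : H → Set Y} {s α ε lam δ : ℝ} {ω ω' : Fin m → Y}

theorem weightSum_nonneg (B : Set H) : 0 ≤ weightSum F mis s α ε lam ω B :=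
  Finset.sum_nonneg fun _ _ => Finset.sum_nonneg fun _ _ =>
    Set.indicator_nonneg (fun _ _ => (weight_pos _ _ _ _ _ _ _ _ _).le) _

theorem weightSum_mono {B B' : Set H} (h : B ⊆ B') :
    weightSum F mis s α ε lam ω B ≤ weightSum F mis s α ε lam ω B' :=
  Finset.sum_le_sum fun _ _ => Finset.sum_le_sum fun _ _ =>
    Set.indicator_le_indicator_of_subset h (fun _ => (weight_pos _ _ _ _ _ _ _ _ _).le) _

theorem weight_le_weightSum (i : Fin k) (j : Fin m) :
    weight F mis s α ε lam ω i (F i (ω j)) ≤ weightSum F mis s α ε lam ω Set.univ := by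
  simp only [weightSum, Set.indicator_univ]
  refine le_trans ?_ (Finset.single_le_sum (f := fun i => ∑ j, weight F mis s α ε lam ω i
    (F i (ω j))) (fun _ _ => Finset.sum_nonneg fun _ _ => (weight_pos _ _ _ _ _ _ _ _ _).le)
    (Finset.mem_univ i))
  exact Finset.single_le_sum (f := fun j => weight F mis s α ε lam ω i (F i (ω j)))
    (fun _ _ => (weight_pos _ _ _ _ _ _ _ _ _).le) (Finset.mem_univ j)

theorem weightSum_univ_pos (hk : 0 < k) (hm : 0 < m) :
    0 < weightSum F mis s α ε lam ω Set.univ :=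
  (weight_pos _ _ _ _ _ _ _ _ _).trans_le (weight_le_weightSum ⟨0, hk⟩ ⟨0, hm⟩)

/-- The candidates that have a small score have a negligible share of the total weight. -/
theorem sum_small_weight_le {c : ℝ} (hanchor : Anchored F mis s α δ ω) (hs : 0 < s)
    (hε : 0 < ε) (hlam : 0 ≤ lam) (hδs : δ ≤ s / 16) (hδε : δ ≤ ε / 16)
    (f : Fin k → Fin m → ℝ)
    (hf : ∀ i j, f i j ≤ Real.exp (lam * c)) (hc : c ≤ 25 / 8) :
    ∑ i, ∑ j, f i j ≤
      k * m * Real.exp (-(lam / 2)) * weightSum F mis s α ε lam ω Set.univ := by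
  obtain ⟨i₀, j₀, hp, he⟩ := hanchor
  have hZ := weight_le_weightSum (F := F) (mis := mis) (s := s) (α := α) (ε := ε) (lam := lam)
    (ω := ω) i₀ j₀
  set p := freq {y | F i₀ y = F i₀ (ω j₀)} ω
  set e := freq (mis (F i₀ (ω j₀))) ω
  have h1 : (15 / 16 : ℝ) ≤ min (p / s) 1 := by
    refine le_min ?_ (by norm_num)
    rw [le_div_iff₀ hs]; linarith
  have h2 : min (max ((e - α) / ε) 0) 1 ≤ 1 / 16 := by
    refine (min_le_left _ _).trans (max_le ?_ (by norm_num))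
    rw [div_le_iff₀ hε]; linarith
  -- The anchor scores at least lam(4 · 15/16 - 1/16) = lam · 59/16, while c + 1/2 ≤ 58/16. This gap
  -- pays for the factor exp(-lam/2).
  have h3 : Real.exp (lam * (c + 1 / 2)) ≤ weightSum F mis s α ε lam ω Set.univ := by
    refine le_trans (Real.exp_le_exp.mpr ?_) hZ
    refine mul_le_mul_of_nonneg_left ?_ hlam
    linarith
  calc ∑ i, ∑ j, f i j ≤ ∑ _i : Fin k, ∑ _j : Fin m, Real.exp (lam * c) :=
        Finset.sum_le_sum fun i _ => Finset.sum_le_sum fun j _ => hf i j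
    _ = k * m * Real.exp (-(lam / 2)) * Real.exp (lam * (c + 1 / 2)) := by
        simp only [Finset.sum_const, Finset.card_univ, Fintype.card_fin, nsmul_eq_mul]
        rw [mul_assoc _ (Real.exp _), ← Real.exp_add, mul_assoc]
        congr 3
        ring
    _ ≤ _ := by gcongr

theorem score_le_of_freq_lt {p e : ℝ} (hs : 0 < s) (hlam : 0 ≤ lam) (hp : p < s / 2) :
    score s α ε lam p e ≤ lam * 2 := by
  refine mul_le_mul_of_nonneg_left ?_ hlam
  have h1 : min (p / s) 1 ≤ 1 / 2 := by
    refine (min_le_left _ _).trans ?_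
    rw [div_le_iff₀ hs]; linarith
  have h2 : 0 ≤ min (max ((e - α) / ε) 0) 1 := le_min (le_max_right _ _) zero_le_one
  linarith

/-- The factor 15/16 leaves room for a deviation δ ≤ ε/16 between empirical and true error, and 4 -
15/16 is still below 25/8. -/
theorem score_le_of_err_gt {p e : ℝ} (hε : 0 < ε) (hlam : 0 ≤ lam) (he : α + ε * (15 / 16) ≤ e) :
    score s α ε lam p e ≤ lam * (25 / 8) := by
  refine mul_le_mul_of_nonneg_left ?_ hlam
  have h1 : min (p / s) 1 ≤ 1 := min_le_right _ _
  have h2 : 15 / 16 ≤ min (max ((e - α) / ε) 0) 1 := by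
    refine le_min (le_max_of_le_left ?_) (by norm_num)
    rw [le_div_iff₀ hε]; linarith
  linarith

/-- Inaccurate candidates have a negligible share of the total weight. -/
theorem weightSum_inaccurate_le {err : H → ℝ} (hanchor : Anchored F mis s α δ ω) (hs : 0 < s)
    (hε : 0 < ε) (hlam : 0 ≤ lam) (hδs : δ ≤ s / 16) (hδε : δ ≤ ε / 16)
    (herr : ∀ i j, |freq (mis (F i (ω j))) ω - err (F i (ω j))| ≤ δ) :
    weightSum F mis s α ε lam ω {h | α + ε < err h} ≤
      k * m * Real.exp (-(lam / 2)) * weightSum F mis s α ε lam ω Set.univ := by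
  refine sum_small_weight_le (c := 25 / 8) hanchor hs hε hlam hδs hδε _ (fun i j => ?_) le_rfl
  by_cases h : F i (ω j) ∈ {h | α + ε < err h}
  · rw [Set.indicator_of_mem h]
    have h1 : α + ε < err (F i (ω j)) := h
    have h2 := (abs_le.mp (herr i j)).1
    exact Real.exp_le_exp.mpr (score_le_of_err_gt hε hlam (by linarith))
  · rw [Set.indicator_of_notMem h]
    positivity

theorem card_filter_eq_freq [DecidableEq H] (hm : 0 < m) (f : Y → H) (h : H) (ω : Fin m → Y) :
    ((Finset.univ.filter fun j => f (ω j) = h).card : ℝ) = m * freq {y | f y = h} ω := by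
  have : (m : ℝ) ≠ 0 := by positivity
  rw [freq, mul_div_cancel₀ _ this, Finset.card_filter]
  push_cast
  refine Finset.sum_congr rfl fun j _ => ?_
  simp [Set.indicator_apply]

/-- The weights of matched samples are, up to a constant factor and a negligible share, the
same. -/
theorem weightSum_le_of_matched (hm : 0 < m) (hanchor : Anchored F mis s α δ ω)
    (hmatch : Matched F mis δ ω ω') (hs : 0 < s) (hs1 : s ≤ 1) (hε : 0 < ε) (hε1 : ε ≤ 1)
    (hlam : 1 ≤ lam) (hδ : 0 ≤ δ) (hδs : δ ≤ s / 16) (hδε : δ ≤ ε / 16) (B : Set H) :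
    weightSum F mis s α ε lam ω B ≤
      k * m * Real.exp (-(lam / 2)) * weightSum F mis s α ε lam ω Set.univ +
      Real.exp (16 * lam * δ / (s * ε)) * weightSum F mis s α ε lam ω' B := by
  classical
  -- Candidates of frequency below s/2 score at most 2 lam and are negligible. For the others a
  -- deviation of 2δ is a small relative error.
  let L : Fin k → Set H := fun i => {h | freq {y | F i y = h} ω < s / 2}
  set E := Real.exp (16 * lam * δ / (s * ε)) with hE
  have hsplit : weightSum F mis s α ε lam ω B =
      ∑ i, ∑ j, (B ∩ L i).indicator (weight F mis s α ε lam ω i) (F i (ω j)) +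
      ∑ i, ∑ j, (B \ L i).indicator (weight F mis s α ε lam ω i) (F i (ω j)) := by
    rw [weightSum, ← Finset.sum_add_distrib]
    refine Finset.sum_congr rfl fun i _ => ?_
    rw [← Finset.sum_add_distrib]
    refine Finset.sum_congr rfl fun j _ => ?_
    by_cases h1 : F i (ω j) ∈ B <;> by_cases h2 : F i (ω j) ∈ L i <;>
      simp [h1, h2]
  rw [hsplit]
  refine add_le_add ?_ ?_
  · refine sum_small_weight_le (c := 2) hanchor hs hε (by linarith) hδs hδε _ (fun i j => ?_)
      (by norm_num)
    by_cases h : F i (ω j) ∈ B ∩ L i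
    · rw [Set.indicator_of_mem h]
      exact Real.exp_le_exp.mpr (score_le_of_freq_lt hs (by linarith) h.2)
    · rw [Set.indicator_of_notMem h]
      positivity
  · rw [weightSum, Finset.mul_sum]
    refine Finset.sum_le_sum fun i _ => ?_
    rw [Finset.mul_sum]
    -- A value h occurs m p times among the candidates of ω and m p' times among those of ω', so the
    -- frequency enters as a multiplicity as well as through the score.
    refine sum_comp_le_of_fiber_le (fun j => F i (ω j)) (fun j => F i (ω' j))
      ((B \ L i).indicator (weight F mis s α ε lam ω i))
      (fun h => E * B.indicator (weight F mis s α ε lam ω' i) h) (fun h => ?_) (fun j => ?_)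
    · exact mul_nonneg (Real.exp_pos _).le
        (Set.indicator_nonneg (fun _ _ => (weight_pos _ _ _ _ _ _ _ _ _).le) _)
    · by_cases h : F i (ω j) ∈ B \ L i
      · rw [Set.indicator_of_mem h, Set.indicator_of_mem h.1, card_filter_eq_freq hm (F i),
          card_filter_eq_freq hm (F i)]
        obtain ⟨h1, h2⟩ := hmatch i j
        have h3 := score_sub_le (α := α) hs hε (by linarith : 0 ≤ lam) h1 h2
        have hL : s / 2 ≤ freq {y | F i y = F i (ω j)} ω := not_lt.mp h.2
        rw [weight, weight]
        set p := freq {y | F i y = F i (ω j)} ω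
        set p' := freq {y | F i y = F i (ω j)} ω'
        -- As p' ≥ s/2 - 2δ ≥ 3s/8, the additive error 2δ is at most p' · 6δ/s.
        have h4 : p ≤ p' * Real.exp (6 * δ / s) := by
          have h5 := (abs_le.mp h1).2
          have h6 : 3 * s / 8 ≤ p' := by linarith
          have h7 : 2 * δ ≤ p' * (6 * δ / s) := by
            have : 3 * s / 8 * (6 * δ / s) ≤ p' * (6 * δ / s) := by gcongr
            have h8 : 3 * s / 8 * (6 * δ / s) = 9 / 4 * δ := by
              field_simp; ring
            linarith
          have h9 := Real.add_one_le_exp (6 * δ / s)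
          have h10 : p' * (6 * δ / s + 1) ≤ p' * Real.exp (6 * δ / s) := by
            have : 0 ≤ p' := by linarith
            gcongr
          linarith
        have hp' : 0 ≤ p' := freq_nonneg _ _
        have h11 : 6 * δ / s + lam * (8 * δ / s + 2 * δ / ε) ≤ 16 * lam * δ / (s * ε) := by
          have e1 : δ / s ≤ δ / (s * ε) := by
            gcongr
            nlinarith
          have e2 : δ / ε ≤ δ / (s * ε) := by
            gcongr
            nlinarith
          have e0 : 0 ≤ δ / (s * ε) := by positivity
          have e3 : 6 * δ / s + lam * (8 * δ / s + 2 * δ / ε) =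
              6 * (δ / s) + lam * (8 * (δ / s) + 2 * (δ / ε)) := by ring
          have e4 : 16 * lam * δ / (s * ε) = lam * (16 * (δ / (s * ε))) := by ring
          rw [e3, e4]
          have e5 : 6 * (δ / s) ≤ lam * (6 * (δ / (s * ε))) := by nlinarith
          have e6 : lam * (8 * (δ / s) + 2 * (δ / ε)) ≤ lam * (10 * (δ / (s * ε))) := by
            gcongr
            linarith
          linarith
        calc m * p * Real.exp (score s α ε lam p (freq (mis (F i (ω j))) ω))
            ≤ m * (p' * Real.exp (6 * δ / s)) *
              Real.exp (score s α ε lam p' (freq (mis (F i (ω j))) ω') +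
                lam * (8 * δ / s + 2 * δ / ε)) := by gcongr
          _ = m * p' * (Real.exp (6 * δ / s + lam * (8 * δ / s + 2 * δ / ε)) *
              Real.exp (score s α ε lam p' (freq (mis (F i (ω j))) ω'))) := by
            rw [Real.exp_add, Real.exp_add]; ring
          _ ≤ _ := by
            have := Real.exp_le_exp.mpr h11
            gcongr
      · rw [Set.indicator_of_notMem h, mul_zero]
        exact mul_nonneg (Nat.cast_nonneg _) (mul_nonneg (Real.exp_pos _).le
          (Set.indicator_nonneg (fun _ _ => (weight_pos _ _ _ _ _ _ _ _ _).le) _))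

/-- The selection probabilities of matched samples are close. -/
theorem weightSum_div_le_of_matched (hk : 0 < k) (hm : 0 < m)
    (hanchor : Anchored F mis s α δ ω) (hanchor' : Anchored F mis s α δ ω')
    (hmatch : Matched F mis δ ω ω') (hmatch' : Matched F mis δ ω' ω)
    (hs : 0 < s) (hs1 : s ≤ 1) (hε : 0 < ε) (hε1 : ε ≤ 1) (hlam : 1 ≤ lam) (hδ : 0 ≤ δ)
    (hδs : δ ≤ s / 16) (hδε : δ ≤ ε / 16) {τ : ℝ} (hτ0 : 0 ≤ τ) (hτ1 : τ ≤ 1)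
    (hθ : k * m * Real.exp (-(lam / 2)) ≤ τ / 16) (hγ : 16 * lam * δ / (s * ε) ≤ τ / 32)
    (B : Set H) :
    weightSum F mis s α ε lam ω B / weightSum F mis s α ε lam ω Set.univ ≤
      weightSum F mis s α ε lam ω' B / weightSum F mis s α ε lam ω' Set.univ + τ / 2 := by
  have h1 := weightSum_le_of_matched hm hanchor hmatch hs hs1 hε hε1 hlam hδ hδs hδε B
  -- With the roles exchanged, the comparison of total weights bounds the normalizer of ω' by that
  -- of ω.
  have h2 := weightSum_le_of_matched hm hanchor' hmatch' hs hs1 hε hε1 hlam hδ hδs hδε Set.univ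
  have hZ := weightSum_univ_pos (F := F) (mis := mis) (s := s) (α := α) (ε := ε) (lam := lam)
    (ω := ω) hk hm
  have hZ' := weightSum_univ_pos (F := F) (mis := mis) (s := s) (α := α) (ε := ε) (lam := lam)
    (ω := ω') hk hm
  have hb := weightSum_nonneg (F := F) (mis := mis) (s := s) (α := α) (ε := ε) (lam := lam)
    (ω := ω') B
  have hbu := weightSum_mono (F := F) (mis := mis) (s := s) (α := α) (ε := ε) (lam := lam)
    (ω := ω') (Set.subset_univ B)
  set Z := weightSum F mis s α ε lam ω Set.univ
  set Z' := weightSum F mis s α ε lam ω' Set.univ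
  set b := weightSum F mis s α ε lam ω B
  set b' := weightSum F mis s α ε lam ω' B
  set θ := k * m * Real.exp (-(lam / 2))
  set γ := 16 * lam * δ / (s * ε)
  have hE : Real.exp γ ≤ 1 + τ / 16 := by
    have hγ0 : 0 ≤ γ := by positivity
    have h3 := Real.abs_exp_sub_one_sub_id_le (x := γ) (by rw [abs_of_nonneg hγ0]; linarith)
    have h4 := (abs_le.mp h3).2
    nlinarith
  set E := Real.exp γ
  have hE0 : 0 < E := Real.exp_pos _
  have h5 : Z' * (1 - τ / 16) ≤ (1 + τ / 16) * Z := by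
    have := mul_le_mul_of_nonneg_right hθ hZ'.le
    have := mul_le_mul_of_nonneg_right hE hZ.le
    nlinarith
  have h6 : b ≤ τ / 16 * Z + (1 + τ / 16) * b' := by
    have := mul_le_mul_of_nonneg_right hθ hZ.le
    have := mul_le_mul_of_nonneg_right hE hb
    linarith
  rw [div_le_iff₀ hZ]
  have h7 : Z' ≤ (1 + 3 / 16 * τ) * Z := by
    refine le_of_mul_le_mul_right (h5.trans ?_) (by linarith : 0 < 1 - τ / 16)
    have : 1 + τ / 16 ≤ (1 + 3 / 16 * τ) * (1 - τ / 16) := by nlinarith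
    nlinarith
  have h8 : b' ≤ b' / Z' * ((1 + 3 / 16 * τ) * Z) := by
    have : b' = b' / Z' * Z' := by field_simp
    conv_lhs => rw [this]
    gcongr
  have h9 : b' / Z' ≤ 1 := div_le_one_of_le₀ hbu hZ'.le
  have h10 : 0 ≤ b' / Z' := by positivity
  set x := b' / Z'
  have h11 : (1 + τ / 16) * b' ≤ (1 + τ / 16) * (x * ((1 + 3 / 16 * τ) * Z)) := by gcongr
  -- The 7/16 here and the 1/16 of the negligible share add up to τ/2.
  have h12 : (1 + τ / 16) * (x * ((1 + 3 / 16 * τ) * Z)) ≤ (x + 7 / 16 * τ) * Z := by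
    have : (1 + τ / 16) * (x * (1 + 3 / 16 * τ)) ≤ x + 7 / 16 * τ := by
      have e1 : (1 + τ / 16) * (1 + 3 / 16 * τ) ≤ 1 + 7 / 16 * τ := by nlinarith
      have e2 := mul_le_mul_of_nonneg_left e1 h10
      have e3 : x * (7 / 16 * τ) ≤ 1 * (7 / 16 * τ) := by gcongr
      linarith
    calc _ = (1 + τ / 16) * (x * (1 + 3 / 16 * τ)) * Z := by ring
      _ ≤ _ := by gcongr
  linarith

end Selection

/-! ### Splitting a sample into independent blocks. -/

section Blocks

/-- The blocks of `l` consecutive entries of a sequence of length `m * l`. -/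
def blocks {Z : Type*} {m l : ℕ} (S : Fin (m * l) → Z) : Fin m → Fin l → Z :=
  fun i j => S (finProdFinEquiv (i, j))

theorem measurePreserving_blocks {Z : Type*} [MeasurableSpace Z] (D : Measure Z)
    [IsProbabilityMeasure D] (m l : ℕ) :
    MeasurePreserving (blocks (Z := Z) (m := m) (l := l)) (Measure.pi fun _ => D)
      (Measure.pi fun _ => Measure.pi fun _ => D) := by
  have h1 : MeasurePreserving
      (fun (S : Fin (m * l) → Z) (p : Fin m × Fin l) => S (finProdFinEquiv p))
      (Measure.pi fun _ => D) (Measure.pi fun _ => D) := by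
    refine ⟨by fun_prop, ?_⟩
    refine (Measure.pi_eq fun s hs => ?_).symm
    rw [Measure.map_apply (by fun_prop) (MeasurableSet.univ_pi hs)]
    have : (fun (S : Fin (m * l) → Z) (p : Fin m × Fin l) => S (finProdFinEquiv p)) ⁻¹'
        Set.univ.pi s = Set.univ.pi fun i => s (finProdFinEquiv.symm i) := by
      ext S
      simp only [Set.mem_preimage, Set.mem_univ_pi]
      exact ⟨fun h i => by simpa only [Equiv.apply_symm_apply] using h (finProdFinEquiv.symm i),
        fun h p => by simpa only [Equiv.symm_apply_apply] using h (finProdFinEquiv p)⟩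
    rw [this, Measure.pi_pi]
    exact finProdFinEquiv.symm.prod_comp fun p => D (s p)
  have h2 : MeasurePreserving (MeasurableEquiv.curry (Fin m) (Fin l) Z)
      (Measure.pi fun _ => D) (Measure.pi fun _ => Measure.pi fun _ => D) := by
    refine ⟨(MeasurableEquiv.curry (Fin m) (Fin l) Z).measurable, ?_⟩
    have h := Measure.infinitePi_map_curry (ι := Fin m) (κ := Fin l) (X := Z)
      (μ := fun _ _ => D)
    simpa only [Measure.infinitePi_eq_pi] using h
  exact h2.comp h1

/-- The first n examples of a block feed the learning rule; the last one is kept as a test example.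
-/
theorem measurePreserving_castSucc {Z : Type*} [MeasurableSpace Z] (D : Measure Z)
    [IsProbabilityMeasure D] (n : ℕ) :
    MeasurePreserving (fun (y : Fin (n + 1) → Z) (l : Fin n) => y l.castSucc)
      (Measure.pi fun _ => D) (Measure.pi fun _ => D) := by
  have h := (measurePreserving_snd (μ := D) (ν := Measure.pi fun _ : Fin n => D)).comp
    (measurePreserving_piFinSuccAbove (fun _ : Fin (n + 1) => D) (Fin.last n))
  convert h using 1
  ext y l
  simp [MeasurableEquiv.piFinSuccAbove, Fin.insertNthEquiv, Fin.init]

end Blocks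

/-! ### Probabilities of the bad events. -/

section EventBounds

variable {Y H : Type*} [MeasurableSpace Y] [MeasurableSpace H] [StandardBorelSpace H] {k m : ℕ}
  {F : Fin k → Y → H} {M : Set (H × Y)} {Q : Measure Y} [IsProbabilityMeasure Q]
  {s α δ : ℝ}

theorem two_exp_le_two_exp {m : ℕ} (hm : 1 ≤ m) (δ : ℝ) :
    ENNReal.ofReal (2 * Real.exp (-(2 * m * δ ^ 2))) ≤
      ENNReal.ofReal (2 * Real.exp (-((m - 1) * δ ^ 2 / 2))) := by
  have : (1 : ℝ) ≤ m := by exact_mod_cast hm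
  gcongr
  nlinarith [sq_nonneg δ]

omit [StandardBorelSpace H] in
-- Each candidate is determined by one entry of the sample, so the union bound runs over km pairs
-- (i, j), however rich H is.
theorem prob_empirical_dev_le (hF : ∀ i, Measurable (F i)) (hM : MeasurableSet M) (hδ : 0 ≤ δ)
    (hm : 1 / (m : ℝ) ≤ δ / 2) :
    (Measure.pi fun _ : Fin m => Q) {ω | ∃ i j,
      δ < |freq (Prod.mk (F i (ω j)) ⁻¹' M) ω - Q.real (Prod.mk (F i (ω j)) ⁻¹' M)|} ≤
      ENNReal.ofReal (k * m * (2 * Real.exp (-((m - 1) * δ ^ 2 / 2)))) := by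
  have hW (i : Fin k) : MeasurableSet {p : Y × Y | (F i p.1, p.2) ∈ M} :=
    (((hF i).comp measurable_fst).prodMk measurable_snd) hM
  simp only [Set.ofPred_exists]
  calc _ ≤ ∑ _i : Fin k, ∑ _j : Fin m,
        ENNReal.ofReal (2 * Real.exp (-((m - 1) * δ ^ 2 / 2))) := by
        refine (measure_iUnion_fintype_le _ _).trans (Finset.sum_le_sum fun i _ => ?_)
        refine (measure_iUnion_fintype_le _ _).trans (Finset.sum_le_sum fun j _ => ?_)
        exact prob_freq_dev_own_le (hW i) hδ hm j
    _ = _ := by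
        simp only [Finset.sum_const, Finset.card_univ, Fintype.card_fin, nsmul_eq_mul]
        rw [mul_assoc, ENNReal.ofReal_mul (Nat.cast_nonneg k),
          ENNReal.ofReal_mul (Nat.cast_nonneg m), ENNReal.ofReal_natCast,
          ENNReal.ofReal_natCast]

/-- Both empirical values are compared with the true probability, by the own-sample bound for the
first sample and by independence for the second. Two kinds of sets, two deviations and Hoeffding's
factor 2 make the 8. -/
theorem prob_not_matched_le (hF : ∀ i, Measurable (F i)) (hM : MeasurableSet M) (hδ : 0 ≤ δ)
    (hm : 1 / (m : ℝ) ≤ δ / 2) (hm1 : 1 ≤ m) :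
    ((Measure.pi fun _ : Fin m => Q).prod (Measure.pi fun _ : Fin m => Q))
      {p | ¬ Matched F (fun h => Prod.mk h ⁻¹' M) δ p.1 p.2} ≤
      ENNReal.ofReal (k * m * (8 * Real.exp (-((m - 1) * δ ^ 2 / 2)))) := by
  set μ := Measure.pi fun _ : Fin m => Q
  let c := ENNReal.ofReal (2 * Real.exp (-((m - 1) * δ ^ 2 / 2)))
  have hW₁ (i : Fin k) : MeasurableSet {p : Y × Y | F i p.2 = F i p.1} :=
    measurableSet_eq_fun ((hF i).comp measurable_snd) ((hF i).comp measurable_fst)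
  have hW₂ (i : Fin k) : MeasurableSet {p : Y × Y | (F i p.1, p.2) ∈ M} :=
    (((hF i).comp measurable_fst).prodMk measurable_snd) hM
  have hpair {W : Set (Y × Y)} (hW : MeasurableSet W) (j : Fin m) :
      (μ.prod μ) {p | 2 * δ < |freq (Prod.mk (p.1 j) ⁻¹' W) p.1 -
        freq (Prod.mk (p.1 j) ⁻¹' W) p.2|} ≤ c + c := by
    have hsub : {p : (Fin m → Y) × (Fin m → Y) | 2 * δ < |freq (Prod.mk (p.1 j) ⁻¹' W) p.1 -
        freq (Prod.mk (p.1 j) ⁻¹' W) p.2|} ⊆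
        Prod.fst ⁻¹' {ω | δ < |freq (Prod.mk (ω j) ⁻¹' W) ω -
          Q.real (Prod.mk (ω j) ⁻¹' W)|} ∪
        {p | δ < |freq (Prod.mk (p.1 j) ⁻¹' W) p.2 - Q.real (Prod.mk (p.1 j) ⁻¹' W)|} := by
      intro p hp
      by_contra hcon
      simp only [Set.mem_union, Set.mem_preimage, Set.mem_ofPred_eq, not_or, not_lt] at hcon hp
      have h3 := abs_sub_le (freq (Prod.mk (p.1 j) ⁻¹' W) p.1)
        (Q.real (Prod.mk (p.1 j) ⁻¹' W)) (freq (Prod.mk (p.1 j) ⁻¹' W) p.2)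
      rw [abs_sub_comm (Q.real _)] at h3
      linarith [hcon.1, hcon.2]
    refine (measure_mono hsub).trans ((measure_union_le _ _).trans (add_le_add ?_ ?_))
    · have hms : MeasurableSet {ω : Fin m → Y | δ < |freq (Prod.mk (ω j) ⁻¹' W) ω -
          Q.real (Prod.mk (ω j) ⁻¹' W)|} := by
        have : Measurable fun ω : Fin m → Y => (ω j, ω) := by fun_prop
        exact this (measurableSet_freq_dev hW δ)
      rw [measurePreserving_fst.measure_preimage hms.nullMeasurableSet]
      exact prob_freq_dev_own_le hW hδ hm j
    · exact (prob_freq_dev_cross_le hW hδ j).trans (two_exp_le_two_exp hm1 δ)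
  have hsub : {p : (Fin m → Y) × (Fin m → Y) |
      ¬ Matched F (fun h => Prod.mk h ⁻¹' M) δ p.1 p.2} ⊆
      ⋃ i, ⋃ j, ({p | 2 * δ < |freq (Prod.mk (p.1 j) ⁻¹' {p : Y × Y | F i p.2 = F i p.1}) p.1 -
        freq (Prod.mk (p.1 j) ⁻¹' {p : Y × Y | F i p.2 = F i p.1}) p.2|} ∪
      {p | 2 * δ < |freq (Prod.mk (p.1 j) ⁻¹' {p : Y × Y | (F i p.1, p.2) ∈ M}) p.1 -
        freq (Prod.mk (p.1 j) ⁻¹' {p : Y × Y | (F i p.1, p.2) ∈ M}) p.2|}) := by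
    intro p hp
    simp only [Matched, Set.mem_ofPred_eq, not_forall] at hp
    obtain ⟨i, j, hij⟩ := hp
    refine Set.mem_iUnion.mpr ⟨i, Set.mem_iUnion.mpr ⟨j, ?_⟩⟩
    rcases not_and_or.mp hij with h | h
    · exact Or.inl (not_le.mp h)
    · exact Or.inr (not_le.mp h)
  calc _ ≤ ∑ _i : Fin k, ∑ _j : Fin m, ((c + c) + (c + c)) := by
        refine (measure_mono hsub).trans ?_
        refine (measure_iUnion_fintype_le _ _).trans (Finset.sum_le_sum fun i _ => ?_)
        refine (measure_iUnion_fintype_le _ _).trans (Finset.sum_le_sum fun j _ => ?_)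
        exact (measure_union_le _ _).trans (add_le_add (hpair (hW₁ i) j) (hpair (hW₂ i) j))
    _ = _ := by
        simp only [Finset.sum_const, Finset.card_univ, Fintype.card_fin, nsmul_eq_mul, c]
        rw [← ENNReal.ofReal_add (by positivity) (by positivity),
          ← ENNReal.ofReal_add (by positivity) (by positivity), mul_assoc (k : ℝ),
          ENNReal.ofReal_mul (Nat.cast_nonneg k),
          ENNReal.ofReal_mul (Nat.cast_nonneg m), ENNReal.ofReal_natCast,
          ENNReal.ofReal_natCast]
        congr 4
        ring

/-- The heavy hitter does not depend on the sample, so two plain Hoeffding bounds suffice. A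
frequency of at least s - δ > 0 makes it one of the candidates. -/
theorem prob_not_anchored_le (hF : ∀ i, Measurable (F i)) (hM : MeasurableSet M) (hδ : 0 ≤ δ)
    (hδs : δ < s) (hm1 : 1 ≤ m)
    (hex : ∃ i h, s ≤ Q.real {y | F i y = h} ∧ Q.real (Prod.mk h ⁻¹' M) ≤ α) :
    (Measure.pi fun _ : Fin m => Q)
      {ω | ¬ Anchored F (fun h => Prod.mk h ⁻¹' M) s α δ ω} ≤
      ENNReal.ofReal (4 * Real.exp (-((m - 1) * δ ^ 2 / 2))) := by
  obtain ⟨i, h, hs, hα⟩ := hex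
  have h1 := prob_freq_dev_le (Q := Q) (m := m) (U := {y | F i y = h})
    (measurableSet_eq_fun (hF i) measurable_const) hδ
  have h2 := prob_freq_dev_le (Q := Q) (m := m) (U := Prod.mk h ⁻¹' M)
    (measurable_prodMk_left hM) hδ
  have hsub : {ω : Fin m → Y | ¬ Anchored F (fun h => Prod.mk h ⁻¹' M) s α δ ω} ⊆
      {ω | δ < |freq {y | F i y = h} ω - Q.real {y | F i y = h}|} ∪
      {ω | δ < |freq (Prod.mk h ⁻¹' M) ω - Q.real (Prod.mk h ⁻¹' M)|} := by
    intro ω hω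
    by_contra hcon
    simp only [Set.mem_union, Set.mem_ofPred_eq, not_or, not_lt] at hcon
    have h3 := (abs_le.mp hcon.1).1
    have h4 := (abs_le.mp hcon.2).2
    have hpos : freq {y | F i y = h} ω ≠ 0 := by
      intro h0
      linarith
    have hj : ∃ j, F i (ω j) = h := by
      by_contra! hne
      refine hpos ?_
      rw [freq, Finset.sum_eq_zero, zero_div]
      intro j _
      exact Set.indicator_of_notMem (by simpa using hne j) _
    obtain ⟨j, rfl⟩ := hj
    exact hω ⟨i, j, by linarith, by linarith⟩
  refine (measure_mono hsub).trans ((measure_union_le _ _).trans ?_)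
  refine (add_le_add (h1.trans (two_exp_le_two_exp hm1 δ))
    (h2.trans (two_exp_le_two_exp hm1 δ))).trans (le_of_eq ?_)
  rw [← ENNReal.ofReal_add (by positivity) (by positivity)]
  congr 1
  ring

/-- Two independent samples are unstable with small probability. -/
theorem prob_unstable_le (hF : ∀ i, Measurable (F i)) (hM : MeasurableSet M) (hδ : 0 ≤ δ)
    (hδs : δ < s) (hm : 1 / (m : ℝ) ≤ δ / 2) (hm1 : 1 ≤ m)
    (hex : ∃ i h, s ≤ Q.real {y | F i y = h} ∧ Q.real (Prod.mk h ⁻¹' M) ≤ α) :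
    ((Measure.pi fun _ : Fin m => Q).prod (Measure.pi fun _ : Fin m => Q))
      {p | ¬ (Anchored F (fun h => Prod.mk h ⁻¹' M) s α δ p.1 ∧
        Anchored F (fun h => Prod.mk h ⁻¹' M) s α δ p.2 ∧
        Matched F (fun h => Prod.mk h ⁻¹' M) δ p.1 p.2 ∧
        Matched F (fun h => Prod.mk h ⁻¹' M) δ p.2 p.1)} ≤
      ENNReal.ofReal (24 * k * m * Real.exp (-((m - 1) * δ ^ 2 / 2))) := by
  set μ := Measure.pi fun _ : Fin m => Q
  set ψ := Real.exp (-((m - 1) * δ ^ 2 / 2))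
  have hψ : 0 < ψ := Real.exp_pos _
  have hk1 : (1 : ℝ) ≤ k := by
    obtain ⟨i, -⟩ := hex
    exact_mod_cast i.pos
  have hm1' : (1 : ℝ) ≤ m := by exact_mod_cast hm1
  have ha := prob_not_anchored_le hF hM hδ hδs hm1 hex
  have hb := prob_not_matched_le (Q := Q) hF hM hδ hm hm1
  have ha1 : (μ.prod μ) (Prod.fst ⁻¹'
      {ω | ¬ Anchored F (fun h => Prod.mk h ⁻¹' M) s α δ ω}) ≤ ENNReal.ofReal (4 * ψ) := by
    refine le_trans ?_ ha
    rw [← Set.prod_univ, Measure.prod_prod, measure_univ, mul_one]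
  have ha2 : (μ.prod μ) (Prod.snd ⁻¹'
      {ω | ¬ Anchored F (fun h => Prod.mk h ⁻¹' M) s α δ ω}) ≤ ENNReal.ofReal (4 * ψ) := by
    refine le_trans ?_ ha
    rw [← Set.univ_prod, Measure.prod_prod, measure_univ, one_mul]
  have hb2 : (μ.prod μ) (Prod.swap ⁻¹'
      {p | ¬ Matched F (fun h => Prod.mk h ⁻¹' M) δ p.1 p.2}) ≤
      ENNReal.ofReal (k * m * (8 * ψ)) := by
    refine le_trans (le_of_eq ?_) hb
    exact (Measure.measurePreserving_swap (μ := μ) (ν := μ)).measure_preimage_equiv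
      (f := MeasurableEquiv.prodComm) _
  have hsub : {p : (Fin m → Y) × (Fin m → Y) |
      ¬ (Anchored F (fun h => Prod.mk h ⁻¹' M) s α δ p.1 ∧
        Anchored F (fun h => Prod.mk h ⁻¹' M) s α δ p.2 ∧
        Matched F (fun h => Prod.mk h ⁻¹' M) δ p.1 p.2 ∧
        Matched F (fun h => Prod.mk h ⁻¹' M) δ p.2 p.1)} ⊆
      (Prod.fst ⁻¹' {ω | ¬ Anchored F (fun h => Prod.mk h ⁻¹' M) s α δ ω} ∪
      Prod.snd ⁻¹' {ω | ¬ Anchored F (fun h => Prod.mk h ⁻¹' M) s α δ ω}) ∪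
      ({p | ¬ Matched F (fun h => Prod.mk h ⁻¹' M) δ p.1 p.2} ∪
      Prod.swap ⁻¹' {p | ¬ Matched F (fun h => Prod.mk h ⁻¹' M) δ p.1 p.2}) := by
    intro p hp
    simp only [Set.mem_union, Set.mem_preimage, Set.mem_ofPred_eq, Prod.fst_swap,
      Prod.snd_swap] at hp ⊢
    tauto
  refine (measure_mono hsub).trans ((measure_union_le _ _).trans ?_)
  refine (add_le_add ((measure_union_le _ _).trans (add_le_add ha1 ha2))
    ((measure_union_le _ _).trans (add_le_add hb hb2))).trans ?_
  rw [← ENNReal.ofReal_add (by positivity) (by positivity),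
    ← ENNReal.ofReal_add (by positivity) (by positivity),
    ← ENNReal.ofReal_add (by positivity) (by positivity)]
  refine ENNReal.ofReal_le_ofReal ?_
  -- As km ≥ 1, the anchoring terms 4ψ + 4ψ merge with 2 · 8kmψ into 24kmψ.
  have : 1 * ψ ≤ k * m * ψ := by
    gcongr
    nlinarith
  linarith

/-- A sample is not anchored or misleading with small probability. -/
theorem prob_misleading_le (hF : ∀ i, Measurable (F i)) (hM : MeasurableSet M) (hδ : 0 ≤ δ)
    (hδs : δ < s) (hm : 1 / (m : ℝ) ≤ δ / 2) (hm1 : 1 ≤ m)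
    (hex : ∃ i h, s ≤ Q.real {y | F i y = h} ∧ Q.real (Prod.mk h ⁻¹' M) ≤ α) :
    (Measure.pi fun _ : Fin m => Q)
      {ω | ¬ (Anchored F (fun h => Prod.mk h ⁻¹' M) s α δ ω ∧ ∀ i j,
        |freq (Prod.mk (F i (ω j)) ⁻¹' M) ω - Q.real (Prod.mk (F i (ω j)) ⁻¹' M)| ≤ δ)} ≤
      ENNReal.ofReal (24 * k * m * Real.exp (-((m - 1) * δ ^ 2 / 2))) := by
  set ψ := Real.exp (-((m - 1) * δ ^ 2 / 2))
  have hψ : 0 < ψ := Real.exp_pos _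
  have hk1 : (1 : ℝ) ≤ k := by
    obtain ⟨i, -⟩ := hex
    exact_mod_cast i.pos
  have hm1' : (1 : ℝ) ≤ m := by exact_mod_cast hm1
  have ha := prob_not_anchored_le hF hM hδ hδs hm1 hex
  have hb := prob_empirical_dev_le (Q := Q) hF hM hδ hm
  have hsub : {ω : Fin m → Y | ¬ (Anchored F (fun h => Prod.mk h ⁻¹' M) s α δ ω ∧ ∀ i j,
        |freq (Prod.mk (F i (ω j)) ⁻¹' M) ω - Q.real (Prod.mk (F i (ω j)) ⁻¹' M)| ≤ δ)} ⊆
      {ω | ¬ Anchored F (fun h => Prod.mk h ⁻¹' M) s α δ ω} ∪ {ω | ∃ i j,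
        δ < |freq (Prod.mk (F i (ω j)) ⁻¹' M) ω - Q.real (Prod.mk (F i (ω j)) ⁻¹' M)|} := by
    intro ω hω
    simp only [Set.mem_union, Set.mem_ofPred_eq, not_and_or, not_forall, not_le] at hω ⊢
    exact hω
  refine (measure_mono hsub).trans ((measure_union_le _ _).trans ((add_le_add ha hb).trans ?_))
  rw [← ENNReal.ofReal_add (by positivity) (by positivity)]
  refine ENNReal.ofReal_le_ofReal ?_
  have : 1 * ψ ≤ k * m * ψ := by
    gcongr
    nlinarith
  linarith

end EventBounds

/-! ### The selection as a kernel, averaged over the random strings. -/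

section SelectionKernel

variable {Y Ω H : Type*} [MeasurableSpace Y] [MeasurableSpace Ω] [MeasurableSpace H]
  [StandardBorelSpace H] {k m : ℕ} {f : Y → Ω → H} {M : Set (H × Y)} {s α ε lam δ : ℝ}

omit [MeasurableSpace Y] in
theorem measurable_freq_of {β : Type*} [MeasurableSpace β] {U : β → Set Y} {g : β → Fin m → Y}
    (h : ∀ j, MeasurableSet {a | g a j ∈ U a}) : Measurable fun a => freq (U a) (g a) := by
  refine Measurable.div_const (Finset.measurable_sum _ fun j _ => ?_) _
  have : (fun a => (U a).indicator (1 : Y → ℝ) (g a j)) = {a | g a j ∈ U a}.indicator 1 := by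
    ext a
    by_cases ha : g a j ∈ U a
    · rw [Set.indicator_of_mem ha, Set.indicator_of_mem (show a ∈ {a | g a j ∈ U a} from ha)]
      rfl
    · rw [Set.indicator_of_notMem ha, Set.indicator_of_notMem (show a ∉ {a | g a j ∈ U a} from ha)]
  rw [this]
  exact measurable_one.indicator (h j)

theorem measurable_freq_eq {β : Type*} [MeasurableSpace β]
    (hf : Measurable fun p : Y × Ω => f p.1 p.2) {g : β → Fin m → Y} (hg : Measurable g)
    {y : β → Y} (hy : Measurable y) {r : β → Ω} (hr : Measurable r) :
    Measurable fun a => freq {z | f z (r a) = f (y a) (r a)} (g a) :=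
  measurable_freq_of fun j => measurableSet_eq_fun
    (hf.comp (((measurable_pi_apply j).comp hg).prodMk hr)) (hf.comp (hy.prodMk hr))

omit [StandardBorelSpace H] in
theorem measurable_freq_mis {β : Type*} [MeasurableSpace β]
    (hf : Measurable fun p : Y × Ω => f p.1 p.2) (hM : MeasurableSet M)
    {g : β → Fin m → Y} (hg : Measurable g)
    {y : β → Y} (hy : Measurable y) {r : β → Ω} (hr : Measurable r) :
    Measurable fun a => freq (Prod.mk (f (y a) (r a)) ⁻¹' M) (g a) :=
  measurable_freq_of fun j =>
    ((hf.comp (hy.prodMk hr)).prodMk ((measurable_pi_apply j).comp hg)) hM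

/-- The distribution of the selected classifier: the candidate `f (ω j) (r i)` is selected with
probability proportional to its weight. -/
def selectionMeasure (f : Y → Ω → H) (M : Set (H × Y)) (s α ε lam : ℝ)
    (p : (Fin m → Y) × (Fin k → Ω)) : Measure H :=
  ∑ i, ∑ j, ENNReal.ofReal
    (weight (fun i y => f y (p.2 i)) (fun h => Prod.mk h ⁻¹' M) s α ε lam p.1 i
      (f (p.1 j) (p.2 i)) /
    weightSum (fun i y => f y (p.2 i)) (fun h => Prod.mk h ⁻¹' M) s α ε lam p.1 Set.univ) •
      Measure.dirac (f (p.1 j) (p.2 i))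

omit [MeasurableSpace Y] [MeasurableSpace Ω] [StandardBorelSpace H] in
theorem selectionMeasure_apply (p : (Fin m → Y) × (Fin k → Ω)) {B : Set H}
    (hB : MeasurableSet B) :
    selectionMeasure f M s α ε lam p B = ENNReal.ofReal
      (weightSum (fun i y => f y (p.2 i)) (fun h => Prod.mk h ⁻¹' M) s α ε lam p.1 B /
      weightSum (fun i y => f y (p.2 i)) (fun h => Prod.mk h ⁻¹' M) s α ε lam p.1 Set.univ) := by
  set Z := weightSum (fun i y => f y (p.2 i)) (fun h => Prod.mk h ⁻¹' M) s α ε lam p.1 Set.univ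
  have hZ : 0 ≤ Z := weightSum_nonneg _
  have hnn (i : Fin k) (j : Fin m) : 0 ≤ B.indicator
      (weight (fun i y => f y (p.2 i)) (fun h => Prod.mk h ⁻¹' M) s α ε lam p.1 i)
      (f (p.1 j) (p.2 i)) / Z :=
    div_nonneg (Set.indicator_nonneg (fun _ _ => (weight_pos _ _ _ _ _ _ _ _ _).le) _) hZ
  have hsum : weightSum (fun i y => f y (p.2 i)) (fun h => Prod.mk h ⁻¹' M) s α ε lam p.1 B / Z =
      ∑ i, ∑ j, B.indicator
      (weight (fun i y => f y (p.2 i)) (fun h => Prod.mk h ⁻¹' M) s α ε lam p.1 i)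
      (f (p.1 j) (p.2 i)) / Z := by
    rw [weightSum, Finset.sum_div]
    exact Finset.sum_congr rfl fun i _ => Finset.sum_div _ _ _
  rw [selectionMeasure, hsum, ENNReal.ofReal_sum_of_nonneg fun i _ => Finset.sum_nonneg fun j _ => hnn i j,
    Measure.finsetSum_apply]
  refine Finset.sum_congr rfl fun i _ => ?_
  rw [ENNReal.ofReal_sum_of_nonneg fun j _ => hnn i j, Measure.finsetSum_apply]
  refine Finset.sum_congr rfl fun j _ => ?_
  rw [Measure.smul_apply, Measure.dirac_apply' _ hB, smul_eq_mul]
  by_cases h : f (p.1 j) (p.2 i) ∈ B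
  · rw [Set.indicator_of_mem h, Set.indicator_of_mem h, Pi.one_apply, mul_one]
  · rw [Set.indicator_of_notMem h, Set.indicator_of_notMem h, mul_zero, zero_div,
      ENNReal.ofReal_zero]

omit [MeasurableSpace Y] [MeasurableSpace Ω] [StandardBorelSpace H] in
theorem isProbabilityMeasure_selectionMeasure (hk : 0 < k) (hm : 0 < m)
    (p : (Fin m → Y) × (Fin k → Ω)) :
    IsProbabilityMeasure (selectionMeasure f M s α ε lam p) := by
  refine ⟨?_⟩
  rw [selectionMeasure_apply _ MeasurableSet.univ, div_self (weightSum_univ_pos hk hm).ne',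
    ENNReal.ofReal_one]

theorem measurable_weight (hf : Measurable fun p : Y × Ω => f p.1 p.2) (hM : MeasurableSet M)
    (i : Fin k) (j : Fin m) :
    Measurable fun p : (Fin m → Y) × (Fin k → Ω) =>
      weight (fun i y => f y (p.2 i)) (fun h => Prod.mk h ⁻¹' M) s α ε lam p.1 i
        (f (p.1 j) (p.2 i)) := by
  have hy : Measurable fun p : (Fin m → Y) × (Fin k → Ω) => p.1 j := by fun_prop
  have hr : Measurable fun p : (Fin m → Y) × (Fin k → Ω) => p.2 i := by fun_prop
  have h1 := measurable_freq_eq hf measurable_fst hy hr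
  have h2 := measurable_freq_mis hf hM measurable_fst hy hr
  unfold weight score
  fun_prop

theorem measurable_selectionMeasure (hf : Measurable fun p : Y × Ω => f p.1 p.2)
    (hM : MeasurableSet M) :
    Measurable (selectionMeasure f M s α ε lam : (Fin m → Y) × (Fin k → Ω) → Measure H) := by
  have hZ : Measurable fun p : (Fin m → Y) × (Fin k → Ω) =>
      weightSum (fun i y => f y (p.2 i)) (fun h => Prod.mk h ⁻¹' M) s α ε lam p.1 Set.univ := by
    simp only [weightSum, Set.indicator_univ]
    exact Finset.measurable_sum _ fun i _ => Finset.measurable_sum _ fun j _ =>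
      measurable_weight hf hM i j
  refine Measure.measurable_of_measurable_coe _ fun B hB => ?_
  simp only [selectionMeasure, Measure.finsetSum_apply, Measure.smul_apply,
    Measure.dirac_apply' _ hB, smul_eq_mul]
  refine Finset.measurable_sum _ fun i _ => Finset.measurable_sum _ fun j _ => ?_
  refine ((measurable_weight hf hM i j).div hZ).ennreal_ofReal.mul ?_
  have : Measurable fun p : (Fin m → Y) × (Fin k → Ω) => (p.1 j, p.2 i) := by fun_prop
  exact (measurable_one.indicator hB).comp (hf.comp this)

theorem measurableSet_anchored {β : Type*} [MeasurableSpace β]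
    (hf : Measurable fun p : Y × Ω => f p.1 p.2) (hM : MeasurableSet M)
    {g : β → Fin m → Y} (hg : Measurable g) {r : β → Fin k → Ω} (hr : Measurable r) :
    MeasurableSet {a | Anchored (fun i y => f y (r a i)) (fun h => Prod.mk h ⁻¹' M) s α δ
      (g a)} := by
  simp only [Anchored, Set.ofPred_exists]
  refine MeasurableSet.iUnion fun i => MeasurableSet.iUnion fun j => ?_
  have hy : Measurable fun a => g a j := by fun_prop
  have hri : Measurable fun a => r a i := by fun_prop
  exact (measurableSet_le measurable_const (measurable_freq_eq hf hg hy hri)).inter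
    (measurableSet_le (measurable_freq_mis hf hM hg hy hri) measurable_const)

theorem measurableSet_matched {β : Type*} [MeasurableSpace β]
    (hf : Measurable fun p : Y × Ω => f p.1 p.2) (hM : MeasurableSet M)
    {g g' : β → Fin m → Y} (hg : Measurable g) (hg' : Measurable g') {r : β → Fin k → Ω}
    (hr : Measurable r) :
    MeasurableSet {a | Matched (fun i y => f y (r a i)) (fun h => Prod.mk h ⁻¹' M) δ
      (g a) (g' a)} := by
  simp only [Matched, Set.ofPred_forall]
  refine MeasurableSet.iInter fun i => MeasurableSet.iInter fun j => ?_
  have hy : Measurable fun a => g a j := by fun_prop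
  have hri : Measurable fun a => r a i := by fun_prop
  have h1 := measurable_freq_eq hf hg hy hri
  have h1' := measurable_freq_eq hf hg' hy hri
  have h2 := measurable_freq_mis hf hM hg hy hri
  have h2' := measurable_freq_mis hf hM hg' hy hri
  exact (measurableSet_le (continuous_abs.measurable.comp (h1.sub h1')) measurable_const).inter
    (measurableSet_le (continuous_abs.measurable.comp (h2.sub h2')) measurable_const)

/-- The parameters of the selection are such that the selected classifier is
indistinguishable up to `ρ` and inaccurate with probability at most `β`. -/
structure IsAdmissible (s g ε ρ β : ℝ) (k m : ℕ) (lam δ : ℝ) : Prop where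
  k_pos : 0 < k
  m_pos : 0 < m
  one_le_lam : 1 ≤ lam
  delta_pos : 0 < δ
  delta_le_s : δ ≤ s / 16
  delta_le_eps : δ ≤ ε / 16
  inv_m_le : 1 / (m : ℝ) ≤ δ / 2
  share_le : k * m * Real.exp (-(lam / 2)) ≤ ρ * β / 16
  drift_le : 16 * lam * δ / (s * ε) ≤ ρ / 32
  fail_le : Real.exp (-(g * k)) + 24 * k * m * Real.exp (-((m - 1) * δ ^ 2 / 2)) ≤ ρ * β / 2

variable {Q : Measure Y} [IsProbabilityMeasure Q] {R : Measure Ω} [IsProbabilityMeasure R]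

theorem prob_forall_mem_le {N : Set Ω} {g : ℝ} (hRN : R N ≤ ENNReal.ofReal (1 - g)) (k : ℕ) :
    Measure.pi (fun _ : Fin k => R) {r | ∀ i, r i ∈ N} ≤
      ENNReal.ofReal (Real.exp (-(g * k))) := by
  have : {r : Fin k → Ω | ∀ i, r i ∈ N} = Set.univ.pi fun _ => N := by ext; simp
  rw [this, Measure.pi_pi, Finset.prod_const, Finset.card_univ, Fintype.card_fin]
  have h1 : R N ≤ ENNReal.ofReal (Real.exp (-g)) :=
    hRN.trans (ENNReal.ofReal_le_ofReal (by linarith [Real.add_one_le_exp (-g)]))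
  refine (pow_le_pow_left' h1 k).trans (le_of_eq ?_)
  rw [← ENNReal.ofReal_pow (Real.exp_pos _).le, ← Real.exp_nat_mul]
  congr 2
  ring

theorem lintegral_le_of_forall_notMem {Ω : Type*} [MeasurableSpace Ω] {R : Measure Ω}
    [IsProbabilityMeasure R] {N : Set Ω} (hN : MeasurableSet N) {a b : ℝ≥0∞} (hRN : R N ≤ a)
    {u : Ω → ℝ≥0∞} (hu1 : ∀ r, u r ≤ 1) (hu : ∀ r ∉ N, u r ≤ b) : ∫⁻ r, u r ∂ R ≤ a + b := by
  calc ∫⁻ r, u r ∂ R ≤ ∫⁻ r, (N.indicator 1 r + b) ∂ R := by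
        refine lintegral_mono fun r => ?_
        by_cases h : r ∈ N
        · simpa [h] using (hu1 r).trans le_self_add
        · simpa [h] using hu r h
    _ = R N + b := by
        rw [lintegral_add_right _ measurable_const, lintegral_indicator_one hN, lintegral_const,
          measure_univ, mul_one]
    _ ≤ _ := by gcongr

/-- The mixture over `r` of the selection measures is stable. -/
theorem exists_mixture_stable (hf : Measurable fun p : Y × Ω => f p.1 p.2)
    (hM : MeasurableSet M) {g ρ β : ℝ} (hs : 0 < s) (hs1 : s ≤ 1) (hε : 0 < ε) (hε1 : ε ≤ 1)
    (hρ : ρ ∈ Set.Ioo (0 : ℝ) 1) (hβ : β ∈ Set.Ioo (0 : ℝ) 1)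
    (hadm : IsAdmissible s g ε ρ β k m lam δ)
    {N : Set Ω} (hN : MeasurableSet N) (hRN : R N ≤ ENNReal.ofReal (1 - g))
    (hgood : ∀ r ∉ N, ∃ h, s ≤ Q.real {y | f y r = h} ∧ Q.real (Prod.mk h ⁻¹' M) ≤ α) :
    ∃ T : (Fin m → Y) × (Fin m → Y) → ℝ≥0∞, Measurable T ∧
      ∫⁻ p, T p ∂((Measure.pi fun _ => Q).prod (Measure.pi fun _ => Q)) ≤ ENNReal.ofReal ρ ∧
      ∀ ω ω' (B : Set H), MeasurableSet B →
        ∫⁻ r : Fin k → Ω, selectionMeasure f M s α ε lam (ω, r) B ∂(Measure.pi fun _ => R) ≤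
        ∫⁻ r : Fin k → Ω, selectionMeasure f M s α ε lam (ω', r) B ∂(Measure.pi fun _ => R) +
          T (ω, ω') := by
  set μ := Measure.pi fun _ : Fin m => Q
  set ν := Measure.pi fun _ : Fin k => R
  let G : Set (((Fin m → Y) × (Fin m → Y)) × (Fin k → Ω)) :=
    {a | Anchored (fun i y => f y (a.2 i)) (fun h => Prod.mk h ⁻¹' M) s α δ a.1.1 ∧
      Anchored (fun i y => f y (a.2 i)) (fun h => Prod.mk h ⁻¹' M) s α δ a.1.2 ∧
      Matched (fun i y => f y (a.2 i)) (fun h => Prod.mk h ⁻¹' M) δ a.1.1 a.1.2 ∧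
      Matched (fun i y => f y (a.2 i)) (fun h => Prod.mk h ⁻¹' M) δ a.1.2 a.1.1}
  have hG : MeasurableSet G := by
    have h1 : Measurable fun a : ((Fin m → Y) × (Fin m → Y)) × (Fin k → Ω) => a.1.1 :=
      measurable_fst.fst
    have h2 : Measurable fun a : ((Fin m → Y) × (Fin m → Y)) × (Fin k → Ω) => a.1.2 :=
      measurable_fst.snd
    exact (measurableSet_anchored hf hM h1 measurable_snd).inter
      ((measurableSet_anchored hf hM h2 measurable_snd).inter
      ((measurableSet_matched hf hM h1 h2 measurable_snd).inter
      (measurableSet_matched hf hM h2 h1 measurable_snd)))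
  have hmeas : Measurable fun p => ν (Prod.mk p ⁻¹' Gᶜ) :=
    measurable_measure_prodMk_left hG.compl
  -- A measurable majorant of the total variation distance, to which Tonelli's theorem applies: ρ/2
  -- for stable strings plus the probability of unstable ones.
  refine ⟨fun p => ENNReal.ofReal (ρ / 2) + ν (Prod.mk p ⁻¹' Gᶜ), measurable_const.add hmeas,
    ?_, ?_⟩
  · have hfub : ∫⁻ p, ν (Prod.mk p ⁻¹' Gᶜ) ∂(μ.prod μ) =
        ∫⁻ r, (μ.prod μ) ((fun p => (p, r)) ⁻¹' Gᶜ) ∂ν := by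
      rw [← Measure.prod_apply hG.compl, Measure.prod_apply_symm hG.compl]
    rw [lintegral_add_left measurable_const, lintegral_const, measure_univ, mul_one, hfub]
    have hNk : MeasurableSet {r : Fin k → Ω | ∀ i, r i ∈ N} := by
      rw [Set.ofPred_forall]
      exact MeasurableSet.iInter fun i => measurable_pi_apply i hN
    -- With the integrals exchanged the strings are fixed first. Unless all of them lie in N, one
    -- supplies a heavy hitter and the concentration bounds over the samples apply.
    have hle := lintegral_le_of_forall_notMem (R := ν) hNk (prob_forall_mem_le hRN k)
      (u := fun r => (μ.prod μ) ((fun p => (p, r)) ⁻¹' Gᶜ))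
      (b := ENNReal.ofReal (24 * k * m * Real.exp (-((m - 1) * δ ^ 2 / 2))))
      (fun r => prob_le_one) (fun r hr => by
        simp only [Set.mem_ofPred_eq, not_forall] at hr
        obtain ⟨i, hi⟩ := hr
        obtain ⟨h, h1, h2⟩ := hgood (r i) hi
        exact prob_unstable_le (F := fun i y => f y (r i))
          (fun i => hf.comp measurable_prodMk_right) hM hadm.delta_pos.le
          (by linarith [hadm.delta_le_s]) hadm.inv_m_le hadm.m_pos ⟨i, h, h1, h2⟩)
    refine (add_le_add le_rfl hle).trans ?_
    rw [← ENNReal.ofReal_add (Real.exp_pos _).le (by positivity),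
      ← ENNReal.ofReal_add (by linarith [hρ.1]) (by positivity)]
    refine ENNReal.ofReal_le_ofReal ?_
    nlinarith [hadm.fail_le, hρ.1, hβ.2]
  · intro ω ω' B hB
    have hν : ν (Prod.mk (ω, ω') ⁻¹' Gᶜ) =
        ∫⁻ r, (Prod.mk (ω, ω') ⁻¹' Gᶜ).indicator 1 r ∂ν :=
      (lintegral_indicator_one (measurable_prodMk_left hG.compl)).symm
    have hκ (ω : Fin m → Y) :
        Measurable fun r : Fin k → Ω => selectionMeasure f M s α ε lam (ω, r) B :=
      ((Measure.measurable_coe hB).comp (measurable_selectionMeasure hf hM)).comp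
        measurable_prodMk_left
    have hconst : ENNReal.ofReal (ρ / 2) = ∫⁻ _ : Fin k → Ω, ENNReal.ofReal (ρ / 2) ∂ν := by
      rw [lintegral_const, measure_univ, mul_one]
    change _ ≤ _ + (ENNReal.ofReal (ρ / 2) + ν (Prod.mk (ω, ω') ⁻¹' Gᶜ))
    rw [hν, hconst, ← lintegral_add_left measurable_const, ← lintegral_add_left (hκ ω')]
    refine lintegral_mono fun r => ?_
    by_cases hr : r ∈ Prod.mk (ω, ω') ⁻¹' Gᶜ
    · rw [Set.indicator_of_mem hr, Pi.one_apply]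
      have := isProbabilityMeasure_selectionMeasure (f := f) (M := M) (s := s) (α := α)
        (ε := ε) (lam := lam) hadm.k_pos hadm.m_pos (ω, r)
      exact prob_le_one.trans (le_add_self.trans le_add_self)
    · rw [Set.indicator_of_notMem hr, add_zero]
      obtain ⟨g1, g2, g3, g4⟩ := not_not.mp hr
      rw [selectionMeasure_apply _ hB, selectionMeasure_apply _ hB,
        ← ENNReal.ofReal_add (div_nonneg (weightSum_nonneg _) (weightSum_nonneg _))
          (by linarith [hρ.1])]
      refine ENNReal.ofReal_le_ofReal ?_
      refine weightSum_div_le_of_matched hadm.k_pos hadm.m_pos g1 g2 g3 g4 hs hs1 hε hε1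
        hadm.one_le_lam hadm.delta_pos.le hadm.delta_le_s hadm.delta_le_eps hρ.1.le hρ.2.le
        ?_ hadm.drift_le B
      -- The product ρβ in `share_le` serves stability and accuracy at once; here β < 1 drops the
      -- second factor.
      nlinarith [hadm.share_le, hρ.1, hβ.2]

/-- The mixture over `r` of the selection measures is accurate. -/
theorem mixture_accurate (hf : Measurable fun p : Y × Ω => f p.1 p.2)
    (hM : MeasurableSet M) {g ρ β : ℝ} (hs : 0 < s) (hε : 0 < ε)
    (hρ : ρ ∈ Set.Ioo (0 : ℝ) 1) (hβ : β ∈ Set.Ioo (0 : ℝ) 1)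
    (hadm : IsAdmissible s g ε ρ β k m lam δ)
    {N : Set Ω} (hN : MeasurableSet N) (hRN : R N ≤ ENNReal.ofReal (1 - g))
    (hgood : ∀ r ∉ N, ∃ h, s ≤ Q.real {y | f y r = h} ∧ Q.real (Prod.mk h ⁻¹' M) ≤ α) :
    ∫⁻ ω, ∫⁻ r : Fin k → Ω, selectionMeasure f M s α ε lam (ω, r)
      {h | α + ε < Q.real (Prod.mk h ⁻¹' M)} ∂(Measure.pi fun _ => R)
      ∂(Measure.pi fun _ : Fin m => Q) ≤ ENNReal.ofReal β := by
  set μ := Measure.pi fun _ : Fin m => Q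
  set ν := Measure.pi fun _ : Fin k => R
  set V : Set H := {h | α + ε < Q.real (Prod.mk h ⁻¹' M)}
  have herr : Measurable fun h : H => Q.real (Prod.mk h ⁻¹' M) :=
    (measurable_measure_prodMk_left hM).ennreal_toReal
  have hV : MeasurableSet V := measurableSet_lt measurable_const herr
  let G : Set ((Fin m → Y) × (Fin k → Ω)) :=
    {a | Anchored (fun i y => f y (a.2 i)) (fun h => Prod.mk h ⁻¹' M) s α δ a.1 ∧
      ∀ i j, |freq (Prod.mk (f (a.1 j) (a.2 i)) ⁻¹' M) a.1 -
        Q.real (Prod.mk (f (a.1 j) (a.2 i)) ⁻¹' M)| ≤ δ}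
  have hG : MeasurableSet G := by
    refine (measurableSet_anchored hf hM measurable_fst measurable_snd).inter ?_
    change MeasurableSet {a : (Fin m → Y) × (Fin k → Ω) | ∀ i j,
      |freq (Prod.mk (f (a.1 j) (a.2 i)) ⁻¹' M) a.1 -
        Q.real (Prod.mk (f (a.1 j) (a.2 i)) ⁻¹' M)| ≤ δ}
    simp only [Set.ofPred_forall]
    refine MeasurableSet.iInter fun i => MeasurableSet.iInter fun j => ?_
    have hy : Measurable fun a : (Fin m → Y) × (Fin k → Ω) => a.1 j := by fun_prop
    have hr : Measurable fun a : (Fin m → Y) × (Fin k → Ω) => a.2 i := by fun_prop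
    have h1 := measurable_freq_mis hf hM measurable_fst hy hr
    have h2 := herr.comp (hf.comp (hy.prodMk hr))
    exact measurableSet_le (continuous_abs.measurable.comp (h1.sub h2)) measurable_const
  have hpt (ω : Fin m → Y) (r : Fin k → Ω) : selectionMeasure f M s α ε lam (ω, r) V ≤
      ENNReal.ofReal (β / 2) + Gᶜ.indicator 1 (ω, r) := by
    by_cases hr : (ω, r) ∈ Gᶜ
    · rw [Set.indicator_of_mem hr, Pi.one_apply]
      have := isProbabilityMeasure_selectionMeasure (f := f) (M := M) (s := s) (α := α)
        (ε := ε) (lam := lam) hadm.k_pos hadm.m_pos (ω, r)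
      exact prob_le_one.trans le_add_self
    · rw [Set.indicator_of_notMem hr, add_zero, selectionMeasure_apply _ hV]
      obtain ⟨g1, g2⟩ := not_not.mp hr
      refine ENNReal.ofReal_le_ofReal ?_
      have h3 := weightSum_inaccurate_le (lam := lam) g1 hs hε (by linarith [hadm.one_le_lam])
        hadm.delta_le_s hadm.delta_le_eps (err := fun h => Q.real (Prod.mk h ⁻¹' M)) g2
      rw [div_le_iff₀ (weightSum_univ_pos hadm.k_pos hadm.m_pos)]
      refine h3.trans (mul_le_mul_of_nonneg_right ?_ (weightSum_nonneg _))
      nlinarith [hadm.share_le, hβ.1, hρ.2]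
  have hfub : ∫⁻ ω, ∫⁻ r, Gᶜ.indicator 1 (ω, r) ∂ν ∂μ =
      ∫⁻ r, μ ((fun ω => (ω, r)) ⁻¹' Gᶜ) ∂ν := by
    rw [← Measure.prod_apply_symm hG.compl, ← lintegral_indicator_one hG.compl,
      lintegral_prod _ (measurable_one.indicator hG.compl).aemeasurable]
  calc _ ≤ ∫⁻ ω, ∫⁻ r, (ENNReal.ofReal (β / 2) + Gᶜ.indicator 1 (ω, r)) ∂ν ∂μ :=
        lintegral_mono fun ω => lintegral_mono fun r => hpt ω r
    _ = ENNReal.ofReal (β / 2) + ∫⁻ r, μ ((fun ω => (ω, r)) ⁻¹' Gᶜ) ∂ν := by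
        simp_rw [lintegral_add_left measurable_const, lintegral_const, measure_univ, mul_one]
        rw [hfub]
    _ ≤ ENNReal.ofReal (β / 2) + (ENNReal.ofReal (Real.exp (-(g * k))) +
        ENNReal.ofReal (24 * k * m * Real.exp (-((m - 1) * δ ^ 2 / 2)))) := by
        have hNk : MeasurableSet {r : Fin k → Ω | ∀ i, r i ∈ N} := by
          rw [Set.ofPred_forall]
          exact MeasurableSet.iInter fun i => measurable_pi_apply i hN
        refine add_le_add le_rfl (lintegral_le_of_forall_notMem hNk (prob_forall_mem_le hRN k)
          (fun r => prob_le_one) (fun r hr => ?_))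
        simp only [Set.mem_ofPred_eq, not_forall] at hr
        obtain ⟨i, hi⟩ := hr
        obtain ⟨h, h1, h2⟩ := hgood (r i) hi
        exact prob_misleading_le (F := fun i y => f y (r i))
          (fun i => hf.comp measurable_prodMk_right) hM hadm.delta_pos.le
          (by linarith [hadm.delta_le_s]) hadm.inv_m_le hadm.m_pos ⟨i, h, h1, h2⟩
    _ ≤ _ := by
        rw [← ENNReal.ofReal_add (Real.exp_pos _).le (by positivity),
          ← ENNReal.ofReal_add (by linarith [hβ.1]) (by positivity)]
        refine ENNReal.ofReal_le_ofReal ?_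
        nlinarith [hadm.fail_le, hβ.1, hρ.2]

end SelectionKernel

/-! ### The amplified learner. -/

section Amplification

variable {X : Type*} [MeasurableSpace X] {H : Set (X → Bool)} {n : ℕ}

/-- The pairs of a classifier and a block whose last example the classifier mislabels. -/
def lastMislabelled (H : Set (X → Bool)) (n : ℕ) : Set (H × Sample X (n + 1)) :=
  {p | (p.1 : X → Bool) (p.2 (Fin.last n)).1 ≠ (p.2 (Fin.last n)).2}

theorem measurableSet_lastMislabelled
    (heval : Measurable fun p : H × X => (p.1 : X → Bool) p.2) (n : ℕ) :
    MeasurableSet (lastMislabelled H n) := by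
  have : Measurable fun p : H × Sample X (n + 1) => (p.1, p.2 (Fin.last n)) := by fun_prop
  exact this (measurableSet_misclassified heval)

theorem sampleLaw_lastMislabelled
    (heval : Measurable fun p : H × X => (p.1 : X → Bool) p.2)
    (D : Measure (X × Bool)) [IsProbabilityMeasure D] (h : H) :
    (sampleLaw D (n + 1)).real (Prod.mk h ⁻¹' lastMislabelled H n) = err D h := by
  have hm : MeasurableSet {z : X × Bool | (h : X → Bool) z.1 ≠ z.2} :=
    measurable_prodMk_left (x := h) (measurableSet_misclassified heval)
  have h1 := (measurePreserving_eval (fun _ : Fin (n + 1) => D) (Fin.last n)).measure_preimage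
    hm.nullMeasurableSet
  rw [err, measureReal_def, measureReal_def, ← h1]
  rfl

/-- String 0 enters only through u and is independent of the others; integrating it out first turns
the selection map into its law given the other strings. -/
theorem map_pi_succ_apply {Ω Ω' H : Type*} [MeasurableSpace Ω] [MeasurableSpace Ω']
    [MeasurableSpace H] {k : ℕ} {R : Measure Ω} [IsProbabilityMeasure R]
    {u : Ω → Ω'} (hu : Measurable u) {sel : (Fin k → Ω) → Ω' → H}
    (hsel : Measurable (Function.uncurry sel)) {B : Set H} (hB : MeasurableSet B) :
    (Measure.pi fun _ : Fin (k + 1) => R).map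
      (fun r => sel (fun i => r i.succ) (u (r 0))) B =
      ∫⁻ r : Fin k → Ω, ((R.map u).map (sel r)) B ∂(Measure.pi fun _ => R) := by
  have hg : Measurable fun q : Ω × (Fin k → Ω) => sel q.2 (u q.1) :=
    hsel.comp (measurable_snd.prodMk (hu.comp measurable_fst))
  have hmp := measurePreserving_piFinSuccAbove (fun _ : Fin (k + 1) => R) 0
  have hcomp : (fun r : Fin (k + 1) → Ω => sel (fun i => r i.succ) (u (r 0))) =
      (fun q : Ω × (Fin k → Ω) => sel q.2 (u q.1)) ∘
        MeasurableEquiv.piFinSuccAbove (fun _ => Ω) 0 := by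
    ext r
    rfl
  rw [hcomp, ← Measure.map_map hg hmp.measurable, hmp.map_eq, Measure.map_apply hg hB,
    Measure.prod_apply_symm (hg hB)]
  refine lintegral_congr fun r => ?_
  have hr : Measurable (sel r) := hsel.comp measurable_prodMk_left
  rw [Measure.map_map hr hu, Measure.map_apply (hr.comp hu) hB]
  rfl

/-- The amplified learner: correlated samples of the learning rule on blocks of examples are
selected according to their frequencies and their empirical errors. -/
theorem exists_amplified [StandardBorelSpace H]
    (heval : Measurable fun p : H × X => (p.1 : X → Bool) p.2)
    {P : Measure H} [IsProbabilityMeasure P] {R : Measure (ℕ → H × ℝ × ℝ)}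
    (hR : IsPoissonPointProcess R (poissonIntensity P))
    (A : Kernel (Sample X n) H) [IsMarkovKernel A] {ρ α β : ℝ} (hρ : ρ ∈ Set.Ioo (0 : ℝ) 1)
    (hβ : 0 ≤ β) (hgap : β < (1 - √(2 * ρ / (ρ + 1))) ^ 2)
    {ρ' ε β' : ℝ} (hρ' : ρ' ∈ Set.Ioo (0 : ℝ) 1) (hε : ε ∈ Set.Ioo (0 : ℝ) 1)
    (hβ' : β' ∈ Set.Ioo (0 : ℝ) 1) {k m : ℕ} {lam δ : ℝ}
    (hadm : IsAdmissible (1 - √(2 * ρ / (ρ + 1))) ((1 - √(2 * ρ / (ρ + 1))) ^ 2 - β) ε ρ' β'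
      k m lam δ) :
    ∃ A' : LearningAlgorithm X H (Fin (k + 1) → ℕ → H × ℝ × ℝ) (m * (n + 1)),
      ∀ (D : Measure (X × Bool)) [IsProbabilityMeasure D],
        IsTVIndistinguishable A D ρ → IsAccurate A D α β → IsAbsContOn A P D →
        IsTVIndistinguishable (A'.rule (Measure.pi fun _ => R)) D ρ' ∧
        IsAccurate (A'.rule (Measure.pi fun _ => R)) D (α + ε) β' := by
  have := hR.isProbabilityMeasure
  have : Nonempty H := nonempty_of_isProbabilityMeasure P
  have hs : 0 < 1 - √(2 * ρ / (ρ + 1)) := by linarith [hadm.delta_pos, hadm.delta_le_s]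
  have hs1 : 1 - √(2 * ρ / (ρ + 1)) ≤ 1 := by linarith [Real.sqrt_nonneg (2 * ρ / (ρ + 1))]
  set s := 1 - √(2 * ρ / (ρ + 1)) with hsdef
  let f : Sample X (n + 1) → (ℕ → H × ℝ × ℝ) → H := fun y r =>
    corrSample A P (fun l => y l.castSucc) r
  have hf : Measurable fun p : Sample X (n + 1) × (ℕ → H × ℝ × ℝ) => f p.1 p.2 := by
    have : Measurable fun p : Sample X (n + 1) × (ℕ → H × ℝ × ℝ) =>
        ((fun l : Fin n => p.1 l.castSucc : Sample X n), p.2) := by fun_prop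
    exact (measurable_corrSample A P).comp this
  have hM := measurableSet_lastMislabelled heval n
  set M := lastMislabelled H n
  let κ : Kernel ((Fin m → Sample X (n + 1)) × (Fin k → ℕ → H × ℝ × ℝ)) H :=
    ⟨selectionMeasure f M s α ε lam, measurable_selectionMeasure hf hM⟩
  have hκ : IsMarkovKernel κ :=
    ⟨fun p => isProbabilityMeasure_selectionMeasure hadm.k_pos hadm.m_pos p⟩
  -- The kernel becomes a deterministic map of a uniform variable, which string 0 provides.
  obtain ⟨sel, hsel, hlaw⟩ := κ.exists_measurable_map_eq_unitInterval
  have hblocks : Measurable (blocks (Z := X × Bool) (m := m) (l := n + 1)) := by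
    unfold blocks; fun_prop
  let A' : LearningAlgorithm X H (Fin (k + 1) → ℕ → H × ℝ × ℝ) (m * (n + 1)) :=
    { toFun := fun p => sel (blocks p.1, fun i => p.2 i.succ) (uniformOf (p.2 0))
      measurable_toFun := by
        refine hsel.comp (((hblocks.comp measurable_fst).prodMk ?_).prodMk
          (measurable_uniformOf.comp ?_))
        · fun_prop
        · fun_prop }
  have hrule (S : Sample X (m * (n + 1))) {B : Set H} (hB : MeasurableSet B) :
      A'.rule (Measure.pi fun _ => R) S B = ∫⁻ r : Fin k → ℕ → H × ℝ × ℝ,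
        selectionMeasure f M s α ε lam (blocks S, r) B ∂(Measure.pi fun _ => R) := by
    rw [LearningAlgorithm.rule_apply]
    have hselS : Measurable (Function.uncurry fun (r : Fin k → ℕ → H × ℝ × ℝ) t =>
        sel (blocks S, r) t) := by
      have : Measurable fun q : (Fin k → ℕ → H × ℝ × ℝ) × unitInterval =>
        ((blocks S, q.1), q.2) := by fun_prop
      exact hsel.comp this
    rw [show (fun r => A'.toFun (S, r)) = fun r : Fin (k + 1) → ℕ → H × ℝ × ℝ =>
      sel (blocks S, fun i => r i.succ) (uniformOf (r 0)) from rfl,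
      map_pi_succ_apply measurable_uniformOf hselS hB, map_uniformOf hR]
    simp_rw [hlaw]
    rfl
  -- The learner is complete before D appears; only its analysis depends on D.
  refine ⟨A', fun D _ hTV hacc hac => ?_⟩
  obtain ⟨N, hN, hRN, hheavy⟩ := exists_accurate_heavy_hitter heval hR hρ hβ hgap hTV hacc hac
  have hgood : ∀ r ∉ N, ∃ h, s ≤ (sampleLaw D (n + 1)).real {y | f y r = h} ∧
      (sampleLaw D (n + 1)).real (Prod.mk h ⁻¹' M) ≤ α := by
    intro r hr
    obtain ⟨h, h1, h2⟩ := hheavy r hr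
    refine ⟨h, h2.trans (le_of_eq ?_), (sampleLaw_lastMislabelled heval D h).le.trans h1⟩
    have hm : MeasurableSet {S : Sample X n | corrSample A P S r = h} :=
      measurableSet_eq_fun ((measurable_corrSample A P).comp measurable_prodMk_right)
        measurable_const
    have h3 := (measurePreserving_castSucc D n).measure_preimage hm.nullMeasurableSet
    rw [measureReal_def, measureReal_def]
    exact congrArg ENNReal.toReal h3.symm
  have hmp : MeasurePreserving (blocks (Z := X × Bool) (m := m) (l := n + 1))
      (sampleLaw D (m * (n + 1))) (Measure.pi fun _ => sampleLaw D (n + 1)) :=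
    measurePreserving_blocks D m (n + 1)
  constructor
  · obtain ⟨T, hT, hTint, hTle⟩ := exists_mixture_stable (Q := sampleLaw D (n + 1)) hf hM hs hs1
      hε.1 hε.2.le hρ' hβ' hadm hN hRN hgood
    calc _ ≤ ∫⁻ S, ∫⁻ S', T (blocks S, blocks S')
          ∂(sampleLaw D (m * (n + 1))) ∂(sampleLaw D (m * (n + 1))) := by
          refine lintegral_mono fun S => lintegral_mono fun S' => ?_
          refine tvDist_le_iff.mpr fun B hB => ?_
          rw [hrule S hB, hrule S' hB]
          exact hTle _ _ B hB
      _ = ∫⁻ p, T p ∂((Measure.pi fun _ => sampleLaw D (n + 1)).prod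
            (Measure.pi fun _ => sampleLaw D (n + 1))) := by
          rw [← (hmp.prod hmp).lintegral_comp hT]
          exact (lintegral_prod _ (hT.comp (hmp.prod hmp).measurable).aemeasurable).symm
      _ ≤ _ := hTint
  · have h := mixture_accurate (Q := sampleLaw D (n + 1)) hf hM hs hε.1 hρ' hβ' hadm hN hRN hgood
    have hV : MeasurableSet {h : H | α + ε < err D h} :=
      measurableSet_lt measurable_const (measurable_err heval D)
    have hV' : {h : H | α + ε < (sampleLaw D (n + 1)).real (Prod.mk h ⁻¹' M)} =
        {h : H | α + ε < err D h} := by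
      ext h
      rw [Set.mem_ofPred_eq, sampleLaw_lastMislabelled heval D h, Set.mem_ofPred_eq]
    rw [hV'] at h
    refine le_trans (le_of_eq ?_) h
    have hmeas : Measurable fun ω : Fin m → Sample X (n + 1) =>
        ∫⁻ r : Fin k → ℕ → H × ℝ × ℝ, selectionMeasure f M s α ε lam (ω, r)
          {h : H | α + ε < err D h} ∂(Measure.pi fun _ => R) :=
      ((Measure.measurable_coe hV).comp
        (measurable_selectionMeasure hf hM)).lintegral_prod_right'
    rw [← hmp.lintegral_comp hmeas]
    exact lintegral_congr fun S => hrule S hV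

end Amplification

/-! ### Choice of the parameters. -/

section Parameters

theorem one_le_log_three_div {β : ℝ} (hβ : β ∈ Set.Ioo (0 : ℝ) 1) : 1 ≤ Real.log (3 / β) := by
  have hβ0 := hβ.1
  rw [Real.le_log_iff_exp_le (by positivity)]
  have h : Real.exp 1 < 3 := by linarith [Real.exp_one_lt_d9]
  refine h.le.trans ?_
  rw [le_div_iff₀ hβ0]
  linarith [hβ.2]

theorem ceil_le_two_mul {x : ℝ} (hx : 1 ≤ x) : (⌈x⌉₊ : ℝ) ≤ 2 * x := by
  linarith [(Nat.ceil_lt_add_one (by linarith : 0 ≤ x)).le]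

/-- With lam = 128 l, the value of δ makes `drift_le` an equality. The lower bound on m gives mδ² ≥
2⁸ l, so exp(-lam/2) and the Hoeffding factor are both at most exp(-64 l). -/
theorem isAdmissible_of_le {s g ε ρ β l : ℝ} {k m : ℕ} (hs : s ∈ Set.Ioc (0 : ℝ) 1)
    (hε : ε ∈ Set.Ioo (0 : ℝ) 1) (hρ : ρ ∈ Set.Ioo (0 : ℝ) 1) (hβ : 0 < β) (hl : 1 ≤ l)
    (hρβ : 1 / Real.exp l ^ 2 ≤ ρ * β) (hk : 0 < k) (hm : 0 < m) (hgk : 7 * l ≤ g * k)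
    (hkm : (k : ℝ) * m * (1 / Real.exp l ^ 64) ≤ 1 / 2 ^ 10 * (ρ * β))
    (hml : 2 ^ 40 * l ^ 3 / (s * ε * ρ) ^ 2 ≤ m) :
    IsAdmissible s g ε ρ β k m (128 * l) (s * ε * ρ / (2 ^ 16 * l)) := by
  obtain ⟨hs0, hs1⟩ := hs
  obtain ⟨hε0, hε1⟩ := hε
  obtain ⟨hρ0, hρ1⟩ := hρ
  have hE2 : 2 ≤ Real.exp l := by linarith [Real.add_one_le_exp l]
  have hqs : s * ε * ρ ≤ s := by
    calc s * ε * ρ ≤ s * 1 * 1 := by gcongr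
      _ = s := by ring
  have hqε : s * ε * ρ ≤ ε := by
    calc s * ε * ρ ≤ 1 * ε * 1 := by gcongr
      _ = ε := by ring
  have hdrift : 16 * (128 * l) * (s * ε * ρ / (2 ^ 16 * l)) / (s * ε) = ρ / 32 := by
    field_simp
    norm_num
  have hq0 : 0 < s * ε * ρ := by positivity
  set q := s * ε * ρ
  have hδq : q / (2 ^ 16 * l) ≤ q / 16 := by
    gcongr
    linarith
  have hmδ : 2 ^ 8 * l ≤ m * (q / (2 ^ 16 * l)) ^ 2 := by
    calc 2 ^ 8 * l = 2 ^ 40 * l ^ 3 / q ^ 2 * (q / (2 ^ 16 * l)) ^ 2 := by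
          field_simp
      _ ≤ _ := by gcongr
  have hδ0 : 0 < q / (2 ^ 16 * l) := by positivity
  set δ := q / (2 ^ 16 * l)
  have hδ1 : δ ≤ 1 := by linarith
  have hδ2 : δ ^ 2 ≤ δ := by nlinarith
  have hexp (j : ℕ) {x : ℝ} (hx : j * l ≤ x) : Real.exp (-x) ≤ 1 / Real.exp l ^ j := by
    rw [Real.exp_neg, ← one_div, ← Real.exp_nat_mul]
    gcongr
  have hρβ0 : 0 < ρ * β := by positivity
  refine ⟨hk, hm, by linarith, hδ0, by linarith, by linarith, ?_, ?_, hdrift.le, ?_⟩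
  · rw [div_le_iff₀ (by exact_mod_cast hm)]
    have : m * δ ^ 2 ≤ m * δ := by gcongr
    linarith
  · have h1 : Real.exp (-(128 * l / 2)) ≤ 1 / Real.exp l ^ 64 :=
      hexp 64 (by push_cast; linarith)
    have h2 : k * m * Real.exp (-(128 * l / 2)) ≤ k * m * (1 / Real.exp l ^ 64) := by gcongr
    linarith
  · have h1 : Real.exp (-((m - 1) * δ ^ 2 / 2)) ≤ 1 / Real.exp l ^ 64 :=
      hexp 64 (by push_cast; linarith)
    have h2 : k * m * Real.exp (-((m - 1) * δ ^ 2 / 2)) ≤ k * m * (1 / Real.exp l ^ 64) := by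
      gcongr
    have h3 : Real.exp (-(g * k)) ≤ 1 / Real.exp l ^ 7 := hexp 7 (by push_cast; linarith)
    have h4 : 1 / Real.exp l ^ 7 ≤ 1 / 32 * (ρ * β) := by
      calc 1 / Real.exp l ^ 7 = 1 / Real.exp l ^ 5 * (1 / Real.exp l ^ 2) := by field_simp
        _ ≤ 1 / 2 ^ 5 * (ρ * β) := by gcongr
        _ = _ := by norm_num
    linarith

/-- Admissible parameters for which the number of blocks is at most quasilinear in `T`. -/
theorem exists_isAdmissible {s g ε ρ β T : ℝ} (hs : s ∈ Set.Ioc (0 : ℝ) 1)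
    (hg : 0 < g) (hgs : g ≤ s ^ 2) (hε : ε ∈ Set.Ioo (0 : ℝ) 1) (hρ : ρ ∈ Set.Ioo (0 : ℝ) 1)
    (hβ : β ∈ Set.Ioo (0 : ℝ) 1)
    (hT : T = Real.log (3 / β) ^ 3 / (g ^ 2 * s * ε ^ 2 * ρ ^ 2)) :
    ∃ (k m : ℕ) (lam δ : ℝ), IsAdmissible s g ε ρ β k m lam δ ∧
      (m : ℝ) ≤ 2 ^ 41 * T * Real.log (Real.exp 1 + T) ^ 3 := by
  obtain ⟨hs0, hs1⟩ := hs
  obtain ⟨hε0, hε1⟩ := hε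
  obtain ⟨hρ0, hρ1⟩ := hρ
  have hL := one_le_log_three_div hβ
  obtain ⟨hβ0, hβ1⟩ := hβ
  set L := Real.log (3 / β) with hLdef
  have hg1 : g ≤ 1 := hgs.trans (by nlinarith)
  have hT0 : 0 < T := by rw [hT]; positivity
  have hTeq : T * (g ^ 2 * s * ε ^ 2 * ρ ^ 2) = L ^ 3 := by rw [hT]; field_simp
  set lT := Real.log (Real.exp 1 + T) with hlT
  have hlT1 : 1 ≤ lT := by
    rw [hlT, Real.le_log_iff_exp_le (by positivity)]; linarith
  -- The product of the logarithms makes exp(l) dominate T, 1/g, 1/ρ and 1/β, while l³ = L³ lT³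
  -- splits into the numerator of T and the logarithmic factor of the bound.
  set l := L * lT with hl
  have hLl : L ≤ l := le_mul_of_one_le_right (by linarith) hlT1
  have hlTl : lT ≤ l := le_mul_of_one_le_left (by linarith) hL
  have hl1 : 1 ≤ l := hL.trans hLl
  set E := Real.exp l with hE
  have hE0 : 0 < E := Real.exp_pos _
  have hlE : l ≤ E := by linarith [Real.add_one_le_exp l]
  have hE2 : 2 ≤ E := by linarith [Real.add_one_le_exp l]
  have hTE : T ≤ E := by
    have h1 : Real.exp lT = Real.exp 1 + T := Real.exp_log (by positivity)
    have h2 : Real.exp lT ≤ E := Real.exp_le_exp.mpr hlTl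
    linarith [Real.exp_pos 1]
  have hL3 : 1 ≤ L ^ 3 := one_le_pow₀ hL
  have hsq {x : ℝ} (h0 : 0 < x) (h1 : x ≤ 1) : x ^ 2 ≤ 1 := pow_le_one₀ h0.le h1
  -- T times its denominator is L³ ≥ 1 and that denominator is at most g, so 1/g ≤ T ≤ E.
  have hgE : 1 ≤ g * E := by
    have h1 : g ^ 2 * s * ε ^ 2 * ρ ^ 2 ≤ g := by
      have h2 : g * (g * s * ε ^ 2 * ρ ^ 2) ≤ g * 1 := by
        have := hsq hε0 hε1.le
        have := hsq hρ0 hρ1.le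
        gcongr
        calc g * s * ε ^ 2 * ρ ^ 2 ≤ 1 * 1 * 1 * 1 := by gcongr
          _ = 1 := by norm_num
      linarith
    have h2 : T * (g ^ 2 * s * ε ^ 2 * ρ ^ 2) ≤ E * g := by gcongr
    linarith
  have hρE : 1 ≤ ρ * E := by
    have h1 : g ^ 2 * s * ε ^ 2 * ρ ^ 2 ≤ ρ := by
      have h2 : g ^ 2 * s * ε ^ 2 * ρ * ρ ≤ 1 * 1 * 1 * 1 * ρ := by
        have := hsq hε0 hε1.le
        have := hsq hg hg1
        gcongr
      linarith
    have h2 : T * (g ^ 2 * s * ε ^ 2 * ρ ^ 2) ≤ E * ρ := by gcongr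
    linarith
  have hβE : 1 ≤ β * E := by
    have h1 : Real.exp L = 3 / β := Real.exp_log (by positivity)
    have h2 : Real.exp L ≤ E := Real.exp_le_exp.mpr hLl
    have h3 : β * (3 / β) ≤ β * E := by rw [← h1]; gcongr
    rw [mul_div_cancel₀ _ hβ0.ne'] at h3
    linarith
  have hρβ : 1 / E ^ 2 ≤ ρ * β := by
    rw [div_le_iff₀ (by positivity)]
    calc (1 : ℝ) = 1 * 1 := by norm_num
      _ ≤ (ρ * E) * (β * E) := by gcongr
      _ = _ := by ring
  set q := s * ε * ρ with hq
  have hq0 : 0 < q := by positivity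
  have hq1 : q ≤ 1 := by
    calc q ≤ 1 * 1 * 1 := by rw [hq]; gcongr
      _ = 1 := by norm_num
  -- From g ≤ s² ≤ s follows g²s ≤ s², so the denominator of T is at most q².
  have hqT : L ^ 3 ≤ T * q ^ 2 := by
    rw [← hTeq]
    have h1 : g ^ 2 * s ≤ s ^ 2 := by
      have : g ≤ s := hgs.trans (by nlinarith)
      calc g ^ 2 * s ≤ s ^ 2 * 1 := by gcongr
        _ = _ := by ring
    calc _ ≤ T * (s ^ 2 * ε ^ 2 * ρ ^ 2) := by gcongr
      _ = _ := by rw [hq]; ring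
  have hkx : 1 ≤ 7 * l / g := by
    rw [le_div_iff₀ hg]; linarith
  have hmx : 1 ≤ 2 ^ 40 * l ^ 3 / q ^ 2 := by
    rw [le_div_iff₀ (by positivity)]
    have : 1 ≤ l ^ 3 := one_le_pow₀ hl1
    have := hsq hq0 hq1
    linarith
  set k := ⌈7 * l / g⌉₊ with hk
  set m := ⌈2 ^ 40 * l ^ 3 / q ^ 2⌉₊ with hm
  have hk1 : 7 * l / g ≤ k := Nat.le_ceil _
  have hk2 : (k : ℝ) ≤ 16 * E ^ 2 := by
    refine (ceil_le_two_mul hkx).trans ?_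
    have h1 : 7 * l / g ≤ 7 * E * E := by
      rw [div_le_iff₀ hg]
      calc 7 * l ≤ 7 * E * 1 := by linarith
        _ ≤ 7 * E * (g * E) := by gcongr
        _ = _ := by ring
    nlinarith
  have hm1 : 2 ^ 40 * l ^ 3 / q ^ 2 ≤ m := Nat.le_ceil _
  have hm2 : (m : ℝ) ≤ 2 ^ 41 * T * lT ^ 3 := by
    refine (ceil_le_two_mul hmx).trans ?_
    have h1 : l ^ 3 / q ^ 2 ≤ T * lT ^ 3 := by
      rw [div_le_iff₀ (by positivity)]
      calc l ^ 3 = L ^ 3 * lT ^ 3 := by rw [hl]; ring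
        _ ≤ (T * q ^ 2) * lT ^ 3 := by gcongr
        _ = _ := by ring
    calc _ = 2 ^ 41 * (l ^ 3 / q ^ 2) := by ring
      _ ≤ 2 ^ 41 * (T * lT ^ 3) := by gcongr
      _ = _ := by ring
  have hm3 : (m : ℝ) ≤ 2 ^ 41 * E ^ 4 := by
    refine hm2.trans ?_
    calc 2 ^ 41 * T * lT ^ 3 ≤ 2 ^ 41 * E * E ^ 3 := by
          have := hlTl.trans hlE
          gcongr
      _ = _ := by ring
  have hkm : (k : ℝ) * m * (1 / E ^ 64) ≤ 1 / 2 ^ 10 * (ρ * β) := by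
    calc (k : ℝ) * m * (1 / E ^ 64) ≤ (16 * E ^ 2) * (2 ^ 41 * E ^ 4) * (1 / E ^ 64) := by
          gcongr
      _ = 2 ^ 45 * (1 / E ^ 56) * (1 / E ^ 2) := by
          field_simp
          norm_num
      _ ≤ 2 ^ 45 * (1 / 2 ^ 56) * (ρ * β) := by gcongr
      _ ≤ _ := by
          have : 0 < ρ * β := by positivity
          nlinarith
  have hkpos : 0 < k := Nat.ceil_pos.mpr (by positivity)
  have hmpos : 0 < m := Nat.ceil_pos.mpr (by positivity)
  refine ⟨k, m, 128 * l, q / (2 ^ 16 * l), ?_, hm2⟩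
  refine isAdmissible_of_le ⟨hs0, hs1⟩ ⟨hε0, hε1⟩ ⟨hρ0, hρ1⟩ hβ0 hl1 hρβ hkpos hmpos ?_ hkm hm1
  rw [div_le_iff₀ hg] at hk1
  linarith

end Parameters

end TVLearning

end

/-! ### The main theorem. -/

theorem mainTheorem8 :
    ∃ (C : ℝ) (m : ℕ), 0 < C ∧
      ∀ (X : Type*) [MeasurableSpace X] (H : Set (X → Bool)) [StandardBorelSpace H]
        (_heval : Measurable fun p : H × X => (p.1 : X → Bool) p.2)
        (P : Measure H) [IsProbabilityMeasure P]
        (R : Measure (ℕ → H × ℝ × ℝ))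
        (_hR : TVLearning.IsPoissonPointProcess R (TVLearning.poissonIntensity P))
        (n : ℕ) (A : Kernel (TVLearning.Sample X n) H) [IsMarkovKernel A]
        (ρ α β : ℝ) (_hρ : ρ ∈ Set.Ioo (0 : ℝ) 1) (_hα : α ∈ Set.Ioo (0 : ℝ) 1)
        (_hβ : β ∈ Set.Ioo (0 : ℝ) 1)
        (_hβρ : β < 2 * ρ / (ρ + 1) - 2 * √(2 * ρ / (ρ + 1)) + 1)
        (ρ' ε β' : ℝ) (_hρ' : ρ' ∈ Set.Ioo (0 : ℝ) 1) (_hε : ε ∈ Set.Ioo (0 : ℝ) 1)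
        (_hβ' : β' ∈ Set.Ioo (0 : ℝ) 1),
        ∃ (n' k : ℕ) (A' : TVLearning.LearningAlgorithm X H (Fin k → ℕ → H × ℝ × ℝ) n'),
          (n' : ℝ) ≤ C * TVLearning.amplFactor ρ β ρ' ε β'
              * Real.log (Real.exp 1 + TVLearning.amplFactor ρ β ρ' ε β') ^ m
              * (max n 1 : ℕ) ∧
          ∀ (D : Measure (X × Bool)) [IsProbabilityMeasure D],
            TVLearning.IsTVIndistinguishable A D ρ →
            TVLearning.IsAccurate A D α β →
            TVLearning.IsAbsContOn A P D →
            TVLearning.IsTVIndistinguishable (A'.rule (Measure.pi fun _ => R)) D ρ' ∧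
            TVLearning.IsAccurate (A'.rule (Measure.pi fun _ => R)) D (α + ε) β' := by
  -- The number of blocks contributes 2⁴¹ and the cubed logarithm; the block length contributes 2,
  -- from n + 1 ≤ 2 max(n, 1).
  refine ⟨2 ^ 42, 3, by positivity, ?_⟩
  intro X _ H _ heval P _ R hR n A _ ρ α β hρ hα hβ hβρ ρ' ε β' hρ' hε hβ'
  have hη0 : 0 ≤ 2 * ρ / (ρ + 1) := div_nonneg (by linarith [hρ.1]) (by linarith [hρ.1])
  have hη1 : 2 * ρ / (ρ + 1) < 1 := by
    rw [div_lt_one (by linarith [hρ.1])]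
    linarith [hρ.2]
  have hsq : (1 - √(2 * ρ / (ρ + 1))) ^ 2 =
      2 * ρ / (ρ + 1) - 2 * √(2 * ρ / (ρ + 1)) + 1 := by
    rw [sub_sq, Real.sq_sqrt hη0]
    ring
  have hs : 1 - √(2 * ρ / (ρ + 1)) ∈ Set.Ioc (0 : ℝ) 1 := by
    refine ⟨?_, by linarith [Real.sqrt_nonneg (2 * ρ / (ρ + 1))]⟩
    rw [sub_pos, Real.sqrt_lt' one_pos]
    simpa using hη1
  have hgap : β < (1 - √(2 * ρ / (ρ + 1))) ^ 2 := hsq ▸ hβρ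
  obtain ⟨k, m, lam, δ, hadm, hm⟩ := TVLearning.exists_isAdmissible
    (T := TVLearning.amplFactor ρ β ρ' ε β') hs (sub_pos.mpr hgap)
    (by linarith [hβ.1]) hε hρ' hβ' (by rw [TVLearning.amplFactor, hsq])
  obtain ⟨A', hA'⟩ := TVLearning.exists_amplified heval hR A hρ hβ.1.le hgap hρ' hε hβ' hadm
  refine ⟨m * (n + 1), k + 1, A', ?_, hA'⟩
  have hn : ((n + 1 : ℕ) : ℝ) ≤ 2 * (max n 1 : ℕ) := by
    have : n + 1 ≤ 2 * max n 1 := by omega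
    exact_mod_cast this
  rw [Nat.cast_mul]
  calc (m : ℝ) * (n + 1 : ℕ) ≤ _ * (2 * (max n 1 : ℕ)) :=
        mul_le_mul hm hn (Nat.cast_nonneg _) ((Nat.cast_nonneg m).trans hm)
    _ = _ := by ring
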